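/- Let $\mathbf{R}$ be a real closed field, i.e. an ordered field such that for every polynomial $P\in\mathbf{R}[X]$ and all $a<b$ in $\mathbf{R}$ with $P(a)P(b)<0$ there is $x\in\,]a,b[$ with $P(x)=0$. Let $\mathbf{C}=\mathbf{R}[i]$ with $i^2=-1$, and $\mathbf{C}^*=\mathbf{C}\smallsetminus\{0\}$. *Cauchy index.* For $P,Q\in\mathbf{R}[X]\smallsetminus\{0\}$, $f=P/Q$ and $a\in\mathbf{R}$, let $\operatorname{Ind}_a^{\pm}(f)$ be $+\frac12$, $-\frac12$ or $0$ according to whether the one-sided limit $\lim_a^{\pm}f$ is $+\infty$, is $-\infty$, or is neither. For $a<b$ put $$\operatorname{Ind}_a^b(f)=\operatorname{Ind}_a^+(f)+\sum_{x\in]a,b[}\bigl(\operatorname{Ind}_x^+(f)-\operatorname{Ind}_x^-(f)\bigr)-\operatorname{Ind}_b^-(f),$$ and $\operatorname{Ind}_a^b(P/Q)=0$ if $P=0$ or $Q=0$. *Sturm index.* For $P,Q\in\mathbf{R}[X]$ with $P\neq0$, iterated euclidean division gives $P_0=Q$, $P_1=P$, $P_{k+1}=Q_kP_k-P_{k-1}$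 with $\deg P_{k+1}<\deg P_k$ for $k\ge1$, until $P_{n+1}=0$. Put $S_k=P_k/P_n$ for $0\le k\le n$; if $P=0$, take the chain $(1)$ instead. For a finite sequence $s$ in $\mathbf{R}$ let $V(s_0,\dots,s_n)=\sum_{k=1}^n\frac12|\operatorname{sign}s_{k-1}-\operatorname{sign}s_k|$, and put $$\operatorname{Sturm}_a^b(P/Q)=V(S_0(a),\dots,S_n(a))-V(S_0(b),\dots,S_n(b)).$$ *Loops.* Let $\Omega$ be the set of piecewise polynomial loops in $\mathbf{C}^*$: maps $\gamma\colon[0,1]\to\mathbf{C}^*$ with $\gamma(0)=\gamma(1)$ for which there are $0=t_0<t_1<\dots<t_n=1$ and $G_1,\dots,G_n\in\mathbf{C}[X]$ with $\gamma(t)=G_k(t)$ for all $t\in[t_{k-1},t_k]$ and all $k$. Such data $(t_k),(G_k)$ are called a presentation of $\gamma$. A map $H\colon[0,1]\times[0,1]\to\mathbf{C}$ is called piecewise polynomial if there are subdivisions $0=s_0<\dots<s_m=1$ and $0=t_0<\dots<t_n=1$ such that $H$ is given on each rectangle $[s_{j-1},s_j]\times[t_{k-1},t_k]$ by a polynomial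 in $\mathbf{C}[X,Y]$. Loops $\gamma_0,\gamma_1\in\Omega$ are homotopic, $\gamma_0\sim\gamma_1$, if there is a piecewise polynomial map $H\colon[0,1]\times[0,1]\to\mathbf{C}^*$ with $H(0,\cdot)=\gamma_0$, $H(1,\cdot)=\gamma_1$ and $H(s,0)=H(s,1)$ for all $s\in[0,1]$. **Theorem.** There is a map $\operatorname{ind}\colon\Omega\to\mathbb{Z}$, the algebraic index, with the following properties. (I0) Computation: for every $\gamma\in\Omega$ and every presentation $(t_k),(G_k)$ of $\gamma$, with $\hat G_k:=G_k\bigl((t_k-t_{k-1})X+t_{k-1}\bigr)$, $$\operatorname{ind}(\gamma)=\sum_{k=1}^n\tfrac12\operatorname{Ind}_0^1\Bigl(\frac{\operatorname{re}\hat G_k}{\operatorname{im}\hat G_k}\Bigr)=\sum_{k=1}^n\tfrac12\operatorname{Sturm}_0^1\Bigl(\frac{\operatorname{re}\hat G_k}{\operatorname{im}\hat G_k}\Bigr).$$ (I1) Normalization: let $x_0<x_1$ and $y_0<y_1$ in $\mathbf{R}$, and suppose that $\gamma\in\Omega$ parametrizes the boundary of the rectangle $\Gamma=[x_0,x_1]\times[y_0,y_1]\subset\mathbf{C}$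 once in the positive sense, i.e. starting at some boundary point it runs weakly monotonically along the edges in the cyclic order of the vertices $(x_0,y_0),(x_1,y_0),(x_1,y_1),(x_0,y_1)$, once around and back to its starting point. Then $\operatorname{ind}(\gamma)=1$ if $0\in\,]x_0,x_1[\,\times\,]y_0,y_1[$, and $\operatorname{ind}(\gamma)=0$ if $0\notin\Gamma$. (I2) Multiplicativity: for all $\gamma_1,\gamma_2\in\Omega$ the pointwise product $\gamma_1\cdot\gamma_2$ lies in $\Omega$, and $\operatorname{ind}(\gamma_1\cdot\gamma_2)=\operatorname{ind}(\gamma_1)+\operatorname{ind}(\gamma_2)$. (I3) Homotopy invariance: for all $\gamma_0,\gamma_1\in\Omega$, if $\gamma_0\sim\gamma_1$, then $\operatorname{ind}(\gamma_0)=\operatorname{ind}(\gamma_1)$. -/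

import Mathlib

open Polynomial

namespace AlgIndex

noncomputable section

/-- An ordered field is real closed if it satisfies the intermediate value property for
polynomials: whenever `P(a) P(b) < 0` with `a < b`, there is `x ∈ ]a,b[` with `P(x) = 0`. -/
def RealClosed (R : Type*) [Field R] [LinearOrder R] : Prop :=
  ∀ (P : R[X]) (a b : R), a < b → P.eval a * P.eval b < 0 →
    ∃ x, a < x ∧ x < b ∧ P.eval x = 0

/-! ### The Cauchy index of a real rational function -/

section Cauchy

variable {R : Type*} [Field R] [LinearOrder R]

/-- The right limit of `f` in `a` is `+∞`. -/
def RightLimTop (f : R → R) (a : R) : Prop :=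
  ∀ M : R, ∃ c, a < c ∧ ∀ x, a < x → x < c → M < f x

/-- The right limit of `f` in `a` is `-∞`. -/
def RightLimBot (f : R → R) (a : R) : Prop :=
  ∀ M : R, ∃ c, a < c ∧ ∀ x, a < x → x < c → f x < M

/-- The left limit of `f` in `a` is `+∞`. -/
def LeftLimTop (f : R → R) (a : R) : Prop :=
  ∀ M : R, ∃ c, c < a ∧ ∀ x, c < x → x < a → M < f x

/-- The left limit of `f` in `a` is `-∞`. -/
def LeftLimBot (f : R → R) (a : R) : Prop :=
  ∀ M : R, ∃ c, c < a ∧ ∀ x, c < x → x < a → f x < M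

open Classical in
/-- `Ind_a^+(f)`: `1/2` or `-1/2` if the right limit of `f` in `a` is `+∞` or `-∞`,
and `0` otherwise. -/
def indRight (f : R → R) (a : R) : ℚ :=
  if RightLimTop f a then 1 / 2 else if RightLimBot f a then -(1 / 2) else 0

open Classical in
/-- `Ind_a^-(f)`: `1/2` or `-1/2` if the left limit of `f` in `a` is `+∞` or `-∞`,
and `0` otherwise. -/
def indLeft (f : R → R) (a : R) : ℚ :=
  if LeftLimTop f a then 1 / 2 else if LeftLimBot f a then -(1 / 2) else 0

/-- The function `x ↦ P(x) / Q(x)` defined by a fraction of polynomials. -/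
def fracFun (P Q : R[X]) : R → R := fun x => P.eval x / Q.eval x

/-- The Cauchy index `Ind_a^b(P/Q)` for `a < b`:
`Ind_a^+ + ∑_{x ∈ ]a,b[} (Ind_x^+ - Ind_x^-) - Ind_b^-`.
Only roots of `Q` can be poles of `P/Q`, so the sum runs over the roots of `Q` in `]a,b[`. -/
def cauchyIndexLt (P Q : R[X]) (a b : R) : ℚ :=
  indRight (fracFun P Q) a
    + ∑ x ∈ Q.roots.toFinset with a < x ∧ x < b,
        (indRight (fracFun P Q) x - indLeft (fracFun P Q) x)
    - indLeft (fracFun P Q) b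

open Classical in
/-- The Cauchy index `Ind_a^b(P/Q)`, for all `a`, `b`; it is `0` in the degenerate case where
`P = 0` or `Q = 0`. -/
def cauchyIndex (P Q : R[X]) (a b : R) : ℚ :=
  if P = 0 ∨ Q = 0 then 0
  else if a < b then cauchyIndexLt P Q a b
  else if b < a then -cauchyIndexLt P Q b a
  else 0

/-! ### Euclidean Sturm chains and the Sturm index -/

/-- The number of sign changes `V(s₀,…,sₙ) = ∑ |sign s_{k-1} - sign s_k| / 2`. -/
def signChanges : List R → ℚ
  | [] => 0
  | [_] => 0
  | x :: y :: l =>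
      |((SignType.sign x : SignType) : ℚ) - ((SignType.sign y : SignType) : ℚ)| / 2
        + signChanges (y :: l)

/-- `V_a^b(S₀,…,Sₙ) = V(S₀(a),…,Sₙ(a)) - V(S₀(b),…,Sₙ(b))`. -/
def signChangesDiff (S : List R[X]) (a b : R) : ℚ :=
  signChanges (S.map (fun P => P.eval a)) - signChanges (S.map (fun P => P.eval b))

end Cauchy

section Euclid

variable {R : Type*} [Field R]

open Classical in
/-- Iterated euclidean division with negative remainders: the list `P₀, P₁, …, Pₙ` with
`P_{k+1} = Q_k P_k - P_{k-1}` and `deg P_{k+1} < deg P_k`, stopping when `P_{n+1} = 0`. -/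
def euclidSeq (P Q : R[X]) : List R[X] :=
  if _h : Q = 0 then [P] else P :: euclidSeq Q (-(P % Q))
termination_by Q.degree
decreasing_by
  rw [degree_neg]
  exact degree_mod_lt P _h

open Classical in
/-- The euclidean Sturm chain `S_k = P_k / P_n` of the fraction `N / D`, where `P₀ = D` and
`P₁ = N`; for `N = 0` it is the chain `(1)`. -/
def sturmChain (N D : R[X]) : List R[X] :=
  if N = 0 then [1]
  else (euclidSeq D N).map (fun P => P / (euclidSeq D N).getLastD 1)

/-- The Sturm index of the fraction `N / D` on `[a,b]`. -/
def sturmIndex [LinearOrder R] (N D : R[X]) (a b : R) : ℚ :=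
  signChangesDiff (sturmChain N D) a b

end Euclid

/-! ### The complex extension `R[i]` -/

/-- The extension `R[i]` with `i ^ 2 = -1`; its elements are `x + y i` with `x`, `y` in `R`. -/
abbrev Cx (R : Type*) [Field R] : Type _ := QuadraticAlgebra R (-1) 0

section Complex

variable {R : Type*} [Field R]

/-- The real part of a polynomial over `R[i]`, taken coefficientwise. -/
def rePoly (G : (Cx R)[X]) : R[X] := G.sum fun n z => monomial n z.re

/-- The imaginary part of a polynomial over `R[i]`, taken coefficientwise. -/
def imPoly (G : (Cx R)[X]) : R[X] := G.sum fun n z => monomial n z.im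

/-- The polynomial `G((b - a) X + a)`. -/
def segPoly (G : (Cx R)[X]) (a b : R) : (Cx R)[X] :=
  G.comp (C (algebraMap R (Cx R) (b - a)) * X + C (algebraMap R (Cx R) a))

variable [LinearOrder R]

/-- The index of the path described by `G` on `[a,b]`: one half of the Cauchy index on `[0,1]`
of real part over imaginary part. -/
def segIndex (G : (Cx R)[X]) (a b : R) : ℚ :=
  1 / 2 * cauchyIndex (rePoly (segPoly G a b)) (imPoly (segPoly G a b)) 0 1

/-- The same expression as `segIndex`, with Sturm indices in place of Cauchy indices. -/
def segSturm (G : (Cx R)[X]) (a b : R) : ℚ :=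
  1 / 2 * sturmIndex (rePoly (segPoly G a b)) (imPoly (segPoly G a b)) 0 1

end Complex

/-! ### Piecewise polynomial loops in `R[i] \ {0}` -/

section Loops

variable (R : Type*) [Field R] [LinearOrder R]

/-- The unit interval of `R`. -/
abbrev UI : Type _ := Set.Icc (0 : R) 1

variable {R}

/-- `0 = t₀ < t₁ < … < tₙ = 1`. -/
def IsSubdivision {n : ℕ} (t : Fin (n + 1) → R) : Prop :=
  StrictMono t ∧ t 0 = 0 ∧ t (Fin.last n) = 1

/-- The path `γ` is given on each `[t_{k-1}, t_k]` of the subdivision by the polynomial `G_k`. -/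
def IsPresentation (γ : UI R → Cx R) {n : ℕ} (t : Fin (n + 1) → R) (G : Fin n → (Cx R)[X]) :
    Prop :=
  IsSubdivision t ∧ ∀ (k : Fin n) (x : UI R), t k.castSucc ≤ x → (x : R) ≤ t k.succ →
    γ x = (G k).eval (algebraMap R (Cx R) x)

/-- A (continuous) piecewise polynomial path `[0,1] → R[i]`. -/
def IsPiecewisePoly (γ : UI R → Cx R) : Prop :=
  ∃ (n : ℕ) (t : Fin (n + 1) → R) (G : Fin n → (Cx R)[X]), IsPresentation γ t G

/-- A piecewise polynomial map `[0,1] × [0,1] → R[i]`: polynomial in two variables on each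
rectangle of a grid. -/
def IsPiecewisePoly₂ (H : UI R → UI R → Cx R) : Prop :=
  ∃ (m n : ℕ) (s : Fin (m + 1) → R) (t : Fin (n + 1) → R) (F : Fin m → Fin n → (Cx R)[X][X]),
    IsSubdivision s ∧ IsSubdivision t ∧
    ∀ (i : Fin m) (j : Fin n) (x y : UI R),
      s i.castSucc ≤ x → (x : R) ≤ s i.succ → t j.castSucc ≤ y → (y : R) ≤ t j.succ →
        H x y = (F i j).evalEval (algebraMap R (Cx R) x) (algebraMap R (Cx R) y)

variable [IsStrictOrderedRing R]

variable (R) in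
/-- The set of piecewise polynomial loops `γ : [0,1] → R[i] \ {0}`, `γ(0) = γ(1)`. -/
def Loops : Set (UI R → Cx R) :=
  {γ | IsPiecewisePoly γ ∧ (∀ x, γ x ≠ 0) ∧ γ 0 = γ 1}

/-- `γ₀` and `γ₁` are joined by a piecewise polynomial homotopy of loops in `R[i] \ {0}`. -/
def Homotopic (γ₀ γ₁ : UI R → Cx R) : Prop :=
  ∃ H : UI R → UI R → Cx R, IsPiecewisePoly₂ H ∧ (∀ x y, H x y ≠ 0) ∧
    (∀ x, H x 0 = H x 1) ∧ H 0 = γ₀ ∧ H 1 = γ₁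

/-- On `[p,q]` the path `γ` runs monotonically along the oriented line segment from `u` to `v`,
from the point `u + l (v - u)` to the point `u + r (v - u)`. -/
def RunsAlong (γ : UI R → Cx R) (p q : UI R) (u v : Cx R) (l r : R) : Prop :=
  ∃ φ : UI R → R, MonotoneOn φ (Set.Icc p q) ∧ φ p = l ∧ φ q = r ∧
    ∀ x ∈ Set.Icc p q, γ x = u + φ x • (v - u)

/-- The vertices `(x₀,y₀), (x₁,y₀), (x₁,y₁), (x₀,y₁)` of the rectangle `[x₀,x₁] × [y₀,y₁]`, in
counter-clockwise order. -/
def corner (x₀ x₁ y₀ y₁ : R) : Fin 4 → Cx R :=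
  ![⟨x₀, y₀⟩, ⟨x₁, y₀⟩, ⟨x₁, y₁⟩, ⟨x₀, y₁⟩]

/-- `γ` is a positively oriented parametrization of the boundary of `[x₀,x₁] × [y₀,y₁]`: it
starts in some point of some edge, runs to the end of this edge, then along the three following
edges, and along the first edge back to the starting point. -/
def ParametrizesBoundary (γ : UI R → Cx R) (x₀ x₁ y₀ y₁ : R) : Prop :=
  ∃ (j : Fin 4) (l : R) (p₁ p₂ p₃ p₄ : UI R), 0 ≤ l ∧ l ≤ 1 ∧
    p₁ ≤ p₂ ∧ p₂ ≤ p₃ ∧ p₃ ≤ p₄ ∧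
    RunsAlong γ 0 p₁ (corner x₀ x₁ y₀ y₁ j) (corner x₀ x₁ y₀ y₁ (j + 1)) l 1 ∧
    RunsAlong γ p₁ p₂ (corner x₀ x₁ y₀ y₁ (j + 1)) (corner x₀ x₁ y₀ y₁ (j + 2)) 0 1 ∧
    RunsAlong γ p₂ p₃ (corner x₀ x₁ y₀ y₁ (j + 2)) (corner x₀ x₁ y₀ y₁ (j + 3)) 0 1 ∧
    RunsAlong γ p₃ p₄ (corner x₀ x₁ y₀ y₁ (j + 3)) (corner x₀ x₁ y₀ y₁ j) 0 1 ∧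
    RunsAlong γ p₄ 1 (corner x₀ x₁ y₀ y₁ j) (corner x₀ x₁ y₀ y₁ (j + 1)) 0 l

end Loops

end

end AlgIndex

/-!
# The algebraic index of piecewise polynomial loops over a real closed field

The index of a path `γ` is half the Cauchy index of the function `re γ / im γ`. `HasIndex` defines
the Cauchy index for arbitrary functions with finitely many jumps, so that it depends on the path
only and is additive under concatenation (`HasIndex.trans`). This makes the sum over the pieces of
a presentation independent of the presentation (`IsPresentation.hasIndex`).

All further properties follow one pattern. By additivity (`interval_induction`) it suffices to
consider intervals inside of which finitely many polynomials have constant sign. There the index is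
a difference of two terms `endTerm`, each given by the signs at one end point and in the interior
(`RealClosed.cauchyIndex_eq`). Every identity thus becomes one about the signs at a single end
point, up to terms that depend on the interior signs only and cancel in the difference. This yields:

* the inversion formula `RealClosed.cauchyIndex_add_swap`, which turns iterated euclidean division
  into Sturm's theorem `RealClosed.cauchyIndex_eq_sturmIndex`, and which computes the index of paths
  in a half plane (`RealClosed.cauchyIndex_of_num_ne_zero`), hence of the sides of a rectangle;
* the product formula `RealClosed.cauchyIndex_product`, with a correction that only depends on the
  end points and thus disappears for loops;
* integrality (`RealClosed.cauchyIndex_turn`): modulo `1` the index is the difference of the values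
  of a coarse angle at the end points.

Homotopy invariance reduces to the statement that a polynomial map `F(s, t)` without zeros on a
rectangle has index `0` along its boundary (`RealClosed.boundaryIndex_eq_zero`). Over a general
real closed field compactness is not available. Instead, the index of `F(s, ·)` is constant in `s`
away from finitely many values (`RealClosed.exists_cauchyIndex_row_eq`), as pseudo-division and
inversion express it by signs of polynomials in `s`. Near each of the remaining values of `s` the
boundary index vanishes (`RealClosed.exists_boundaryIndex_eq_zero`), because the rectangle can be
cut into finitely many rectangles that are mapped into half planes. The latter uses that a
polynomial positive on a closed interval is bounded away from zero there, a consequence of Rolle's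
theorem.
-/

namespace AlgIndex

variable {R : Type*} [Field R] [LinearOrder R]

/-! ### Real polynomials on intervals -/

/-- A property of intervals that is stable under concatenation, and that holds on all intervals
whose interior avoids a finite set, holds on all intervals. -/
theorem interval_induction {α : Type*} [LinearOrder α] (E : Finset α) {Φ : α → α → Prop} {A B : α}
    (htrans : ∀ a b c, A ≤ a → a < b → b < c → c ≤ B → Φ a b → Φ b c → Φ a c)
    (hfree : ∀ a b, A ≤ a → a < b → b ≤ B → (∀ x ∈ E, ¬ (a < x ∧ x < b)) → Φ a b)
    (hAB : A < B) : Φ A B := by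
  classical
  suffices h : ∀ n, ∀ a b, A ≤ a → a < b → b ≤ B →
      (E.filter fun x => a < x ∧ x < b).card = n → Φ a b from h _ A B le_rfl hAB le_rfl rfl
  intro n
  induction n using Nat.strong_induction_on with
  | _ n ih =>
    intro a b ha hab hb hn
    by_cases hE : ∀ x ∈ E, ¬ (a < x ∧ x < b)
    · exact hfree a b ha hab hb hE
    · push Not at hE
      obtain ⟨x, hx, hax, hxb⟩ := hE
      have h1 : (E.filter fun y => a < y ∧ y < x).card < n := by
        rw [← hn]
        refine Finset.card_lt_card (Finset.ssubset_iff_of_subset ?_ |>.2 ⟨x, by simp [*], by simp⟩)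
        intro y; simp only [Finset.mem_filter]
        exact fun h => ⟨h.1, h.2.1, h.2.2.trans hxb⟩
      have h2 : (E.filter fun y => x < y ∧ y < b).card < n := by
        rw [← hn]
        refine Finset.card_lt_card (Finset.ssubset_iff_of_subset ?_ |>.2 ⟨x, by simp [*], by simp⟩)
        intro y; simp only [Finset.mem_filter]
        exact fun h => ⟨h.1, hax.trans h.2.1, h.2.2⟩
      exact htrans a x b ha hax hxb hb (ih _ h1 a x ha hax (hxb.le.trans hb) rfl)
        (ih _ h2 x b (ha.trans hax.le) hxb hb rfl)

/-- `P` vanishes identically or has no root in the open interval `]a,b[`, so that it has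
constant sign there. -/
def SimpleOn (P : R[X]) (a b : R) : Prop :=
  P = 0 ∨ ∀ x, a < x → x < b → P.eval x ≠ 0

theorem simpleOn_of_roots {P : R[X]} {a b : R} (h : ∀ x ∈ P.roots.toFinset, ¬ (a < x ∧ x < b)) :
    SimpleOn P a b := by
  by_cases hP : P = 0
  · exact Or.inl hP
  · exact Or.inr fun x hax hxb hx => h x (by simp [hP, hx]) ⟨hax, hxb⟩

theorem SimpleOn.of_le {P : R[X]} {a b c d : R} (h : ∀ x, a ≤ x → x ≤ b → P.eval x ≠ 0)
    (hac : a ≤ c) (hdb : d ≤ b) : SimpleOn P c d :=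
  Or.inr fun x hcx hxd => h x (hac.trans hcx.le) (hxd.le.trans hdb)

variable [IsStrictOrderedRing R]

theorem sign_eq_of_mul_pos {x y : R} (h : 0 < x * y) : SignType.sign x = SignType.sign y := by
  rcases pos_and_pos_or_neg_and_neg_of_mul_pos h with h | h
  · rw [sign_pos h.1, sign_pos h.2]
  · rw [sign_neg h.1, sign_neg h.2]

theorem RealClosed.sign_eq_of_forall_ne (hR : RealClosed R) {P : R[X]} {a b : R} (hab : a ≤ b)
    (h : ∀ x, a ≤ x → x ≤ b → P.eval x ≠ 0) :
    SignType.sign (P.eval a) = SignType.sign (P.eval b) := by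
  rcases hab.eq_or_lt with rfl | hab
  · rfl
  · have ha := h a le_rfl hab.le
    have hb := h b hab.le le_rfl
    rcases lt_or_gt_of_ne (mul_ne_zero ha hb) with h0 | h0
    · obtain ⟨x, hax, hxb, hx⟩ := hR P a b hab h0
      exact absurd hx (h x hax.le hxb.le)
    · exact sign_eq_of_mul_pos h0

theorem RealClosed.sign_eq (hR : RealClosed R) {P : R[X]} {a b : R} (h : SimpleOn P a b)
    {x y : R} (hax : a < x) (hxb : x < b) (hay : a < y) (hyb : y < b) :
    SignType.sign (P.eval x) = SignType.sign (P.eval y) := by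
  rcases h with rfl | h
  · simp
  · rcases le_total x y with hxy | hxy
    · exact hR.sign_eq_of_forall_ne hxy
        fun z h1 h2 => h z (hax.trans_le h1) (h2.trans_lt hyb)
    · exact (hR.sign_eq_of_forall_ne hxy
        fun z h1 h2 => h z (hay.trans_le h1) (h2.trans_lt hxb)).symm

theorem RealClosed.sign_left (hR : RealClosed R) {P : R[X]} {a b y : R} (h : SimpleOn P a b)
    (ha : P.eval a ≠ 0) (hay : a < y) (hyb : y < b) :
    SignType.sign (P.eval y) = SignType.sign (P.eval a) := by
  rcases h with rfl | h
  · simp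
  · refine (hR.sign_eq_of_forall_ne hay.le fun z h1 h2 => ?_).symm
    rcases h1.eq_or_lt with rfl | h1
    · exact ha
    · exact h z h1 (h2.trans_lt hyb)

theorem RealClosed.sign_right (hR : RealClosed R) {P : R[X]} {a b y : R} (h : SimpleOn P a b)
    (hb : P.eval b ≠ 0) (hay : a < y) (hyb : y < b) :
    SignType.sign (P.eval y) = SignType.sign (P.eval b) := by
  rcases h with rfl | h
  · simp
  · refine hR.sign_eq_of_forall_ne hyb.le fun z h1 h2 => ?_
    rcases h2.eq_or_lt with rfl | h2
    · exact hb
    · exact h z (hay.trans_le h1) h2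

/-- Between two consecutive roots `a < b` write `P = (X - a)^m (X - b)^n S`; the cofactor
`m (X - b) S + n (X - a) S + (X - a) (X - b) S'` of `P'` changes sign between `a` and `b`. -/
theorem RealClosed.rolle_zero (hR : RealClosed R) {P : R[X]} {a b : R} (hab : a < b)
    (hPa : P.eval a = 0) (hPb : P.eval b = 0) (hP : ∀ x, a < x → x < b → P.eval x ≠ 0) :
    ∃ x, a < x ∧ x < b ∧ P.derivative.eval x = 0 := by
  have hP0 : P ≠ 0 := by
    rintro rfl
    obtain ⟨x, hax, hxb⟩ := exists_between hab
    exact hP x hax hxb (by simp)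
  obtain ⟨T, hT, hTa⟩ := Polynomial.exists_eq_pow_rootMultiplicity_mul_and_not_dvd P hP0 a
  have hT0 : T ≠ 0 := by rintro rfl; simp at hTa
  obtain ⟨S, hS, hSb⟩ := Polynomial.exists_eq_pow_rootMultiplicity_mul_and_not_dvd T hT0 b
  have hm : P.rootMultiplicity a ≠ 0 := ((rootMultiplicity_pos hP0).2 hPa).ne'
  have hTb : T.eval b = 0 := by
    rw [hT] at hPb
    simp only [eval_mul, eval_pow, eval_sub, eval_X, eval_C, mul_eq_zero] at hPb
    exact hPb.resolve_left (pow_ne_zero _ (sub_ne_zero.2 hab.ne'))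
  have hn : T.rootMultiplicity b ≠ 0 := ((rootMultiplicity_pos hT0).2 hTb).ne'
  obtain ⟨m, hm⟩ := Nat.exists_eq_succ_of_ne_zero hm
  obtain ⟨n, hn⟩ := Nat.exists_eq_succ_of_ne_zero hn
  rw [hm] at hT
  rw [hn] at hS
  rw [dvd_iff_isRoot, IsRoot.def] at hTa hSb
  have hSa : S.eval a ≠ 0 := fun h => hTa (by rw [hS]; simp [h])
  have hSne : ∀ x, a ≤ x → x ≤ b → S.eval x ≠ 0 := by
    intro x hax hxb hx
    rcases hax.eq_or_lt with rfl | hax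
    · exact hSa hx
    rcases hxb.eq_or_lt with rfl | hxb
    · exact hSb hx
    · exact hP x hax hxb (by rw [hT, hS]; simp [hx])
  set g : R[X] := C (m + 1 : R) * (X - C b) * S + C (n + 1 : R) * (X - C a) * S
    + (X - C a) * (X - C b) * derivative S with hg
  have hder : derivative P = (X - C a) ^ m * (X - C b) ^ n * g := by
    rw [hT, hS, hg]
    simp only [derivative_mul, derivative_X_sub_C_pow, Nat.succ_eq_add_one, Nat.cast_add,
      Nat.cast_one, Nat.add_sub_cancel, C_add, C_1, C_eq_natCast]
    ring
  have hga : g.eval a = (m + 1) * (a - b) * S.eval a := by simp [hg]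
  have hgb : g.eval b = (n + 1) * (b - a) * S.eval b := by simp [hg]
  have hSS : 0 < S.eval a * S.eval b := by
    by_contra hcon
    rcases lt_or_eq_of_le (not_lt.1 hcon) with h | h
    · obtain ⟨x, h1, h2, h3⟩ := hR S a b hab h
      exact hSne x h1.le h2.le h3
    · rcases mul_eq_zero.1 h with h | h
      · exact hSa h
      · exact hSb h
  have hgg : g.eval a * g.eval b < 0 := by
    rw [hga, hgb]
    have : 0 < (m + 1 : R) * (n + 1) * (b - a) ^ 2 * (S.eval a * S.eval b) := by
      have : 0 < b - a := sub_pos.2 hab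
      positivity
    linear_combination this
  obtain ⟨x, h1, h2, h3⟩ := hR g a b hab hgg
  exact ⟨x, h1, h2, by rw [hder]; simp [h3]⟩

theorem RealClosed.rolle (hR : RealClosed R) {P : R[X]} {a b : R} (hab : a < b)
    (h : P.eval a = P.eval b) : ∃ x, a < x ∧ x < b ∧ P.derivative.eval x = 0 := by
  classical
  by_cases hP : P - C (P.eval a) = 0
  · obtain ⟨x, hax, hxb⟩ := exists_between hab
    refine ⟨x, hax, hxb, ?_⟩
    rw [sub_eq_zero.1 hP]; simp
  set Q := P - C (P.eval a) with hQ
  have hne : (Q.roots.toFinset.filter fun x => a < x ∧ x ≤ b).Nonempty :=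
    ⟨b, by simp [hP, hab]; simp [hQ, h]⟩
  obtain ⟨c, hc, hmin⟩ := Finset.exists_min_image _ id hne
  simp only [Finset.mem_filter, Multiset.mem_toFinset, mem_roots hP, id] at hc hmin
  obtain ⟨x, h1, h2, h3⟩ := hR.rolle_zero (P := Q) hc.2.1 (by simp [hQ]) hc.1
    fun x h1 h2 h3 => (hmin x ⟨h3, h1, h2.le.trans hc.2.2⟩).not_gt h2
  exact ⟨x, h1, h2.trans_le hc.2.2, by simpa [hQ] using h3⟩

/-- If `P'` has no root in `]a,b[`, then `P` is bounded below by its values at `a` and `b`: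
otherwise some value would be taken twice. -/
theorem RealClosed.min_le_eval (hR : RealClosed R) {P : R[X]} {a b : R}
    (h : ∀ x, a < x → x < b → P.derivative.eval x ≠ 0) {t : R} (hat : a ≤ t) (htb : t ≤ b) :
    min (P.eval a) (P.eval b) ≤ P.eval t := by
  by_contra hcon
  rw [not_le] at hcon
  obtain ⟨v, hv1, hv2⟩ := exists_between hcon
  obtain ⟨hva, hvb⟩ := lt_min_iff.1 hv2
  have hat' : a < t := hat.lt_of_ne (by rintro rfl; exact absurd (hv1.trans hva) (lt_irrefl _))
  have htb' : t < b := htb.lt_of_ne (by rintro rfl; exact absurd (hv1.trans hvb) (lt_irrefl _))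
  obtain ⟨x, hx1, hx2, hx3⟩ := hR (P - C v) a t hat' (by
    simp only [eval_sub, eval_C]
    exact mul_neg_of_pos_of_neg (sub_pos.2 hva) (sub_neg.2 hv1))
  obtain ⟨y, hy1, hy2, hy3⟩ := hR (P - C v) t b htb' (by
    simp only [eval_sub, eval_C]
    exact mul_neg_of_neg_of_pos (sub_neg.2 hv1) (sub_pos.2 hvb))
  simp only [eval_sub, eval_C, sub_eq_zero] at hx3 hy3
  obtain ⟨z, hz1, hz2, hz3⟩ := hR.rolle (hx2.trans hy1) (hx3.trans hy3.symm)
  exact h z (hx1.trans hz1) (hz2.trans hy2) hz3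

/-- A polynomial that is positive on a closed interval is bounded away from zero there; over a
real closed field this replaces compactness of the interval. -/
theorem RealClosed.exists_pos_le_eval (hR : RealClosed R) {P : R[X]} {a b : R} (hab : a < b)
    (h : ∀ x, a ≤ x → x ≤ b → 0 < P.eval x) : ∃ δ > 0, ∀ x, a ≤ x → x ≤ b → δ ≤ P.eval x := by
  refine interval_induction P.derivative.roots.toFinset
    (Φ := fun a b => ∃ δ > 0, ∀ x, a ≤ x → x ≤ b → δ ≤ P.eval x) ?_ ?_ hab
  · rintro a b c - - - - ⟨δ, hδ, h1⟩ ⟨δ', hδ', h2⟩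
    refine ⟨min δ δ', lt_min hδ hδ', fun x hax hxc => ?_⟩
    rcases le_total x b with hxb | hxb
    · exact (min_le_left _ _).trans (h1 x hax hxb)
    · exact (min_le_right _ _).trans (h2 x hxb hxc)
  · intro c d hac hcd hdb hE
    refine ⟨min (P.eval c) (P.eval d),
      lt_min (h c hac (hcd.le.trans hdb)) (h d (hac.trans hcd.le) hdb), fun x hcx hxd => ?_⟩
    rcases simpleOn_of_roots hE with h0 | h0
    · rw [eq_C_of_derivative_eq_zero h0]; simp
    · exact hR.min_le_eval h0 hcx hxd

end AlgIndex

namespace AlgIndex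

/-! ### One-sided indices of rational functions -/

section OneSided

variable {R : Type*} [Field R] [LinearOrder R]

omit [Field R] in
theorem indRight_congr {f g : R → R} {a b : R} (hab : a < b)
    (h : ∀ x, a < x → x < b → f x = g x) : indRight f a = indRight g a := by
  have key : ∀ {f g : R → R}, (∀ x, a < x → x < b → f x = g x) →
      (RightLimTop f a → RightLimTop g a) ∧ (RightLimBot f a → RightLimBot g a) := by
    refine fun {f g} h => ⟨fun hf M => ?_, fun hf M => ?_⟩ <;>
    · obtain ⟨c, hc, hM⟩ := hf M
      refine ⟨min c b, lt_min hc hab, fun x hax hx => ?_⟩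
      rw [← h x hax (hx.trans_le (min_le_right _ _))]
      exact hM x hax (hx.trans_le (min_le_left _ _))
  have h' : ∀ x, a < x → x < b → g x = f x := fun x h1 h2 => (h x h1 h2).symm
  have h1 : RightLimTop f a ↔ RightLimTop g a := ⟨(key h).1, (key h').1⟩
  have h2 : RightLimBot f a ↔ RightLimBot g a := ⟨(key h).2, (key h').2⟩
  rw [indRight, indRight, h1, h2]

omit [Field R] in
theorem indLeft_congr {f g : R → R} {a b : R} (hab : a < b)
    (h : ∀ x, a < x → x < b → f x = g x) : indLeft f b = indLeft g b := by
  have key : ∀ {f g : R → R}, (∀ x, a < x → x < b → f x = g x) →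
      (LeftLimTop f b → LeftLimTop g b) ∧ (LeftLimBot f b → LeftLimBot g b) := by
    refine fun {f g} h => ⟨fun hf M => ?_, fun hf M => ?_⟩ <;>
    · obtain ⟨c, hc, hM⟩ := hf M
      refine ⟨max c a, max_lt hc hab, fun x hx hxb => ?_⟩
      rw [← h x ((le_max_right _ _).trans_lt hx) hxb]
      exact hM x ((le_max_left _ _).trans_lt hx) hxb
  have h' : ∀ x, a < x → x < b → g x = f x := fun x h1 h2 => (h x h1 h2).symm
  have h1 : LeftLimTop f b ↔ LeftLimTop g b := ⟨(key h).1, (key h').1⟩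
  have h2 : LeftLimBot f b ↔ LeftLimBot g b := ⟨(key h).2, (key h').2⟩
  rw [indLeft, indLeft, h1, h2]

variable [IsStrictOrderedRing R]

/-- An increasing affine substitution does not change one-sided indices. -/
theorem indRight_comp_affine (f : R → R) {m : R} (hm : 0 < m) (c a : R) :
    indRight (fun x => f (m * x + c)) a = indRight f (m * a + c) := by
  have h1 : ∀ p : R → R → Prop, (∃ d, a < d ∧ ∀ x, a < x → x < d → p (f (m * x + c)) 0) ↔
      ∃ d, m * a + c < d ∧ ∀ x, m * a + c < x → x < d → p (f x) 0 := by
    refine fun p => ⟨fun ⟨d, hd, h⟩ => ⟨m * d + c, by gcongr, fun x h1 h2 => ?_⟩,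
      fun ⟨d, hd, h⟩ => ⟨(d - c) / m, by rw [lt_div_iff₀ hm]; linarith, fun x h1 h2 =>
        h _ (by gcongr) (by rw [lt_div_iff₀ hm] at h2; linarith)⟩⟩
    have := h ((x - c) / m) (by rw [lt_div_iff₀ hm]; linarith) (by rw [div_lt_iff₀ hm]; linarith)
    rwa [mul_div_cancel₀ _ hm.ne', sub_add_cancel] at this
  have hT : RightLimTop (fun x => f (m * x + c)) a ↔ RightLimTop f (m * a + c) :=
    forall_congr' fun M => h1 fun u _ => M < u
  have hB : RightLimBot (fun x => f (m * x + c)) a ↔ RightLimBot f (m * a + c) :=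
    forall_congr' fun M => h1 fun u _ => u < M
  rw [indRight, indRight, hT, hB]

theorem indLeft_eq_indRight_neg (f : R → R) (a : R) :
    indLeft f a = indRight (fun x => f (-x)) (-a) := by
  have h1 : ∀ p : R → R → Prop, (∃ d, d < a ∧ ∀ x, d < x → x < a → p (f x) 0) ↔
      ∃ d, -a < d ∧ ∀ x, -a < x → x < d → p (f (-x)) 0 := by
    refine fun p => ⟨fun ⟨d, hd, h⟩ => ⟨-d, by linarith, fun x h1 h2 => h _ (by linarith)
      (by linarith)⟩, fun ⟨d, hd, h⟩ => ⟨-d, by linarith, fun x h1 h2 => ?_⟩⟩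
    have := h (-x) (by linarith) (by linarith)
    rwa [neg_neg] at this
  have hT : LeftLimTop f a ↔ RightLimTop (fun x => f (-x)) (-a) :=
    forall_congr' fun M => h1 fun u _ => M < u
  have hB : LeftLimBot f a ↔ RightLimBot (fun x => f (-x)) (-a) :=
    forall_congr' fun M => h1 fun u _ => u < M
  rw [indLeft, indRight, hT, hB]

theorem indLeft_comp_affine (f : R → R) {m : R} (hm : 0 < m) (c a : R) :
    indLeft (fun x => f (m * x + c)) a = indLeft f (m * a + c) := by
  rw [indLeft_eq_indRight_neg, indLeft_eq_indRight_neg]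
  have := indRight_comp_affine (fun x => f (-x)) hm (-c) (-a)
  rw [show -(m * a + c) = m * -a + -c by ring, ← this]
  congr 1; ext x; congr 1; ring

/-- The sign of `x` as a rational number. -/
def sgn (x : R) : ℚ := ((SignType.sign x : SignType) : ℚ)

omit [IsStrictOrderedRing R] in
@[simp] theorem sgn_zero : sgn (0 : R) = 0 := by simp [sgn]

omit [IsStrictOrderedRing R] in
theorem sgn_pos {x : R} (h : 0 < x) : sgn x = 1 := by simp [sgn, sign_pos h]

omit [IsStrictOrderedRing R] in
theorem sgn_neg {x : R} (h : x < 0) : sgn x = -1 := by simp [sgn, sign_neg h]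

theorem sgn_mul (x y : R) : sgn (x * y) = sgn x * sgn y := by simp [sgn, sign_mul]

theorem sgn_neg_eq (x : R) : sgn (-x) = -sgn x := by
  rw [← neg_one_mul, sgn_mul, sgn_neg (by simp : (-1 : R) < 0), neg_one_mul]

omit [IsStrictOrderedRing R] in
theorem sgn_congr {x y : R} (h : SignType.sign x = SignType.sign y) : sgn x = sgn y := by
  rw [sgn, sgn, h]

/-- The contribution of an end point of a segment to the Cauchy index: `p` and `q` are the values
of numerator and denominator at the end point, and `s` is a value of the denominator inside the
segment, of which only the sign matters. -/
def endTerm (p q s : R) : ℚ := if q = 0 then sgn p * sgn s else 0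

omit [IsStrictOrderedRing R] in
theorem not_rightLimTop_zero (a : R) [DenselyOrdered R] : ¬ RightLimTop (fun _ => (0 : R)) a :=
  fun h => by
    obtain ⟨c, hc, hx⟩ := h 0
    obtain ⟨x, h1, h2⟩ := exists_between hc
    exact lt_irrefl _ (hx x h1 h2)

theorem indRight_zero (a : R) : indRight (fun _ => (0 : R)) a = 0 := by
  have : ¬ RightLimBot (fun _ => (0 : R)) a := fun h => by
    obtain ⟨c, hc, hx⟩ := h 0
    obtain ⟨x, h1, h2⟩ := exists_between hc
    exact lt_irrefl _ (hx x h1 h2)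
  simp [indRight, this, not_rightLimTop_zero]

theorem indLeft_zero (a : R) : indLeft (fun _ => (0 : R)) a = 0 := by
  rw [indLeft_eq_indRight_neg, indRight_zero]

theorem rightLim_not_both {f : R → R} {a : R} (h1 : RightLimTop f a) (h2 : RightLimBot f a) :
    False := by
  obtain ⟨c, hc, h⟩ := h1 0
  obtain ⟨d, hd, h'⟩ := h2 0
  obtain ⟨x, hx1, hx2⟩ := exists_between (lt_min hc hd)
  exact lt_asymm (h x hx1 (hx2.trans_le (min_le_left _ _)))
    (h' x hx1 (hx2.trans_le (min_le_right _ _)))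

open Filter Topology in
theorem rightLimTop_iff [TopologicalSpace R] [OrderTopology R] {f : R → R} {a : R} :
    RightLimTop f a ↔ Tendsto f (𝓝[>] a) atTop := by
  constructor
  · intro h
    refine tendsto_atTop.2 fun M => ?_
    obtain ⟨c, hc, hx⟩ := h M
    exact mem_nhdsGT_iff_exists_Ioo_subset.2 ⟨c, hc, fun x hx' => (hx x hx'.1 hx'.2).le⟩
  · intro h M
    obtain ⟨c, hc, hx⟩ := mem_nhdsGT_iff_exists_Ioo_subset.1 (h.eventually_gt_atTop M)
    exact ⟨c, hc, fun x h1 h2 => hx ⟨h1, h2⟩⟩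

open Filter Topology in
theorem rightLimTop_of_denom_pos {P Q : R[X]} {a b : R} (hab : a < b)
    (hQ : ∀ x, a < x → x < b → 0 < Q.eval x) (hQa : Q.eval a = 0) (hPa : 0 < P.eval a) :
    RightLimTop (fracFun P Q) a := by
  let _ : TopologicalSpace R := Preorder.topology R
  have : OrderTopology R := ⟨rfl⟩
  rw [rightLimTop_iff]
  have hQt : Tendsto (fun x => Q.eval x) (𝓝[>] a) (𝓝[>] 0) := by
    refine tendsto_nhdsWithin_iff.2 ⟨?_, ?_⟩
    · have := (Q.continuous.tendsto a).mono_left (nhdsWithin_le_nhds (s := Set.Ioi a))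
      rwa [hQa] at this
    · exact mem_nhdsGT_iff_exists_Ioo_subset.2 ⟨b, hab, fun x hx => hQ x hx.1 hx.2⟩
  have hPt : Tendsto (fun x => P.eval x) (𝓝[>] a) (𝓝 (P.eval a)) :=
    (P.continuous.tendsto a).mono_left nhdsWithin_le_nhds
  have := hPt.pos_mul_atTop hPa (tendsto_inv_nhdsGT_zero.comp hQt)
  exact this.congr fun x => by simp [fracFun, div_eq_mul_inv]

open Filter Topology in
theorem not_rightLimTop_of_denom_ne_zero {P Q : R[X]} {a : R} (hQa : Q.eval a ≠ 0) :
    ¬ RightLimTop (fracFun P Q) a := by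
  let _ : TopologicalSpace R := Preorder.topology R
  have : OrderTopology R := ⟨rfl⟩
  rw [rightLimTop_iff]
  have h : Tendsto (fracFun P Q) (𝓝[>] a) (𝓝 (P.eval a / Q.eval a)) :=
    ((P.continuous.tendsto a).div (Q.continuous.tendsto a) hQa).mono_left nhdsWithin_le_nhds
  exact not_tendsto_atTop_of_tendsto_nhds h

theorem rightLimBot_neg {f : R → R} {a : R} :
    RightLimBot (fun x => -f x) a ↔ RightLimTop f a := by
  constructor <;> intro h M <;> obtain ⟨c, hc, hx⟩ := h (-M) <;>
    exact ⟨c, hc, fun x h1 h2 => by have := hx x h1 h2; linarith⟩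

omit [LinearOrder R] [IsStrictOrderedRing R] in
theorem fracFun_neg (P Q : R[X]) : fracFun P Q = fun x => -fracFun (-P) Q x := by
  ext x; simp [fracFun, neg_div]

omit [LinearOrder R] [IsStrictOrderedRing R] in
theorem fracFun_neg_neg (P Q : R[X]) : fracFun (-P) (-Q) = fracFun P Q := by
  ext x; simp [fracFun, neg_div_neg_eq]

theorem indRight_of_denom_ne_zero {P Q : R[X]} {a : R} (hQa : Q.eval a ≠ 0) :
    indRight (fracFun P Q) a = 0 := by
  have h1 := not_rightLimTop_of_denom_ne_zero (P := P) hQa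
  have h2 : ¬ RightLimBot (fracFun P Q) a := by
    rw [fracFun_neg, rightLimBot_neg]
    exact not_rightLimTop_of_denom_ne_zero hQa
  simp [indRight, h1, h2]

theorem RealClosed.indRight_eq (hR : RealClosed R) {P Q : R[X]} {a b y : R}
    (hQ : SimpleOn Q a b) (ha : Q.eval a = 0 → P.eval a ≠ 0) (hay : a < y) (hyb : y < b) :
    indRight (fracFun P Q) a = 1 / 2 * endTerm (P.eval a) (Q.eval a) (Q.eval y) := by
  have hab := hay.trans hyb
  by_cases hQa : Q.eval a = 0
  swap
  · rw [indRight_of_denom_ne_zero hQa, endTerm, if_neg hQa, mul_zero]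
  have hsgn : ∀ x, a < x → x < b → SignType.sign (Q.eval x) = SignType.sign (Q.eval y) :=
    fun x h1 h2 => hR.sign_eq hQ h1 h2 hay hyb
  rw [endTerm, if_pos hQa]
  have top : ∀ {P Q : R[X]}, Q.eval a = 0 → 0 < P.eval a → 0 < Q.eval y →
      (∀ x, a < x → x < b → SignType.sign (Q.eval x) = SignType.sign (Q.eval y)) →
      RightLimTop (fracFun P Q) a := fun h1 h2 h3 h4 =>
    rightLimTop_of_denom_pos hab
      (fun x hx1 hx2 => by have := h4 x hx1 hx2; rwa [sign_pos h3, sign_eq_one_iff] at this) h1 h2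
  have top' : ∀ {P Q : R[X]}, Q.eval a = 0 → P.eval a < 0 → Q.eval y < 0 →
      (∀ x, a < x → x < b → SignType.sign (Q.eval x) = SignType.sign (Q.eval y)) →
      RightLimTop (fracFun P Q) a := by
    intro P Q h1 h2 h3 h4
    rw [← fracFun_neg_neg]
    exact top (by simp [h1]) (by simpa using h2) (by simpa using h3)
      fun x hx1 hx2 => by simp [Left.sign_neg, h4 x hx1 hx2]
  rcases hQ with rfl | hQ
  · have : fracFun P 0 = fun _ : R => (0 : R) := by ext; simp [fracFun]
    simp [this, indRight_zero]
  have hone : RightLimTop (fracFun P Q) a → indRight (fracFun P Q) a = 1 / 2 := fun h => by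
    simp [indRight, h]
  have hneg : RightLimBot (fracFun P Q) a → indRight (fracFun P Q) a = -(1 / 2) := fun h => by
    have : ¬ RightLimTop (fracFun P Q) a := fun h' => rightLim_not_both h' h
    simp only [indRight, h, this, if_true, if_false]
  rcases lt_or_gt_of_ne (ha hQa) with hp | hp <;> rcases lt_or_gt_of_ne (hQ y hay hyb) with hq | hq
  · rw [hone (top' hQa hp hq hsgn), sgn_neg hp, sgn_neg hq]; norm_num
  · rw [hneg (by rw [fracFun_neg, rightLimBot_neg]; exact top hQa (by simpa using hp) hq hsgn),
      sgn_neg hp, sgn_pos hq]; norm_num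
  · rw [hneg (by rw [fracFun_neg, rightLimBot_neg]; exact top' hQa (by simpa using hp) hq hsgn),
      sgn_pos hp, sgn_neg hq]; norm_num
  · rw [hone (top hQa hp hq hsgn), sgn_pos hp, sgn_pos hq]; norm_num

omit [LinearOrder R] [IsStrictOrderedRing R] in
theorem fracFun_comp_neg (P Q : R[X]) :
    (fun x => fracFun P Q (-x)) = fracFun (P.comp (-X)) (Q.comp (-X)) := by
  ext x; simp [fracFun]

theorem indLeft_of_denom_ne_zero {P Q : R[X]} {a : R} (hQa : Q.eval a ≠ 0) :
    indLeft (fracFun P Q) a = 0 := by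
  rw [indLeft_eq_indRight_neg, fracFun_comp_neg]
  exact indRight_of_denom_ne_zero (by simpa using hQa)

theorem RealClosed.indLeft_eq (hR : RealClosed R) {P Q : R[X]} {a b y : R}
    (hQ : SimpleOn Q a b) (hb : Q.eval b = 0 → P.eval b ≠ 0) (hay : a < y) (hyb : y < b) :
    indLeft (fracFun P Q) b = 1 / 2 * endTerm (P.eval b) (Q.eval b) (Q.eval y) := by
  rw [indLeft_eq_indRight_neg, fracFun_comp_neg]
  have hQ' : SimpleOn (Q.comp (-X)) (-b) (-a) := by
    rcases hQ with rfl | hQ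
    · exact Or.inl (by simp)
    · exact Or.inr fun x h1 h2 => by simpa using hQ (-x) (by linarith) (by linarith)
  have := hR.indRight_eq (P := P.comp (-X)) hQ' (y := -y) (by simpa using hb) (by linarith)
    (by linarith)
  simpa using this

end OneSided

/-! ### The index of a function on an interval -/

section LineIndex

variable {R : Type*} [Field R] [LinearOrder R]

/-- The jump of `f` at `x`, counted as in the Cauchy index. -/
noncomputable def jump (f : R → R) (x : R) : ℚ := indRight f x - indLeft f x

/-- The function `f` has Cauchy index `q` on `[a,b]`. In contrast to `cauchyIndexLt`, the sum runs
over all jumps of `f` in `]a,b[`, which are required to be finite in number; hence this depends only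
on the restriction of `f` to `]a,b[` and not on a presentation of `f` as a fraction. -/
def HasIndex (f : R → R) (a b : R) (q : ℚ) : Prop :=
  (Set.Ioo a b ∩ Function.support (jump f)).Finite ∧
    indRight f a + ∑ᶠ x ∈ Set.Ioo a b, jump f x - indLeft f b = q

omit [Field R] in
theorem HasIndex.unique {f : R → R} {a b : R} {q r : ℚ} (h : HasIndex f a b q)
    (h' : HasIndex f a b r) : q = r := h.2.symm.trans h'.2

omit [Field R] in
theorem jump_congr {f g : R → R} {a b x : R} (h : ∀ x, a < x → x < b → f x = g x) (hax : a < x)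
    (hxb : x < b) : jump f x = jump g x := by
  rw [jump, jump, indRight_congr hxb fun y h1 h2 => h y (hax.trans h1) h2,
    indLeft_congr hax fun y h1 h2 => h y h1 (h2.trans hxb)]

omit [Field R] in
theorem HasIndex.congr {f g : R → R} {a b : R} {q : ℚ} (hf : HasIndex f a b q) (hab : a < b)
    (h : ∀ x, a < x → x < b → f x = g x) : HasIndex g a b q := by
  refine ⟨hf.1.subset ?_, ?_⟩
  · rintro x ⟨hx, hx'⟩
    refine ⟨hx, ?_⟩
    rwa [Function.mem_support, jump_congr h hx.1 hx.2]
  · rw [← hf.2, indRight_congr hab h, indLeft_congr hab h]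
    congr 2
    exact finsum_mem_congr rfl fun x hx => (jump_congr h hx.1 hx.2).symm

omit [Field R] in
theorem HasIndex.trans {f : R → R} {a b c : R} {q r : ℚ} (h1 : HasIndex f a b q)
    (h2 : HasIndex f b c r) (hab : a < b) (hbc : b < c) : HasIndex f a c (q + r) := by
  have hset : Set.Ioo a c = Set.Ioo a b ∪ ({b} ∪ Set.Ioo b c) := by
    ext x
    simp only [Set.mem_Ioo, Set.mem_union, Set.mem_singleton_iff]
    constructor
    · rintro ⟨h1, h2⟩
      rcases lt_trichotomy x b with h | h | h
      · exact Or.inl ⟨h1, h⟩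
      · exact Or.inr (Or.inl h)
      · exact Or.inr (Or.inr ⟨h, h2⟩)
    · rintro (h | rfl | h)
      · exact ⟨h.1, h.2.trans hbc⟩
      · exact ⟨hab, hbc⟩
      · exact ⟨hab.trans h.1, h.2⟩
  have hd1 : Disjoint ({b} : Set R) (Set.Ioo b c) := by simp
  have hd2 : Disjoint (Set.Ioo a b) ({b} ∪ Set.Ioo b c) := by
    rw [Set.disjoint_left]
    rintro x hx (rfl | hx')
    · exact lt_irrefl _ hx.2
    · exact lt_asymm hx.2 hx'.1
  have hfb : (({b} : Set R) ∩ Function.support (jump f)).Finite :=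
    (Set.finite_singleton b).inter_of_left _
  have hf2 : (({b} ∪ Set.Ioo b c) ∩ Function.support (jump f)).Finite := by
    rw [Set.union_inter_distrib_right]; exact hfb.union h2.1
  refine ⟨by rw [hset, Set.union_inter_distrib_right]; exact h1.1.union hf2, ?_⟩
  rw [hset, finsum_mem_union' hd2 h1.1 hf2, finsum_mem_union' hd1 hfb h2.1,
    finsum_mem_singleton, ← h1.2, ← h2.2, jump]
  ring

variable [IsStrictOrderedRing R]

theorem hasIndex_zero (a b : R) : HasIndex (fun _ => (0 : R)) a b 0 := by
  have : jump (fun _ => (0 : R)) = 0 := by ext x; simp [jump, indRight_zero, indLeft_zero]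
  refine ⟨by simp [this], by simp [this, indRight_zero, indLeft_zero]⟩

theorem HasIndex.comp_affine {f : R → R} {a b : R} {q : ℚ} (h : HasIndex f a b q) (hab : a < b) :
    HasIndex (fun x => f ((b - a) * x + a)) 0 1 q := by
  have hm : 0 < b - a := sub_pos.2 hab
  have hj : ∀ x, jump (fun x => f ((b - a) * x + a)) x = jump f ((b - a) * x + a) := fun x => by
    rw [jump, jump, indRight_comp_affine f hm, indLeft_comp_affine f hm]
  have hinj : Function.Injective fun x => (b - a) * x + a := fun x y hxy => by
    simpa [hm.ne'] using hxy
  have hbij : Set.BijOn (fun x => (b - a) * x + a) (Set.Ioo 0 1) (Set.Ioo a b) := by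
    refine ⟨fun x hx => ⟨?_, ?_⟩, hinj.injOn, fun y hy => ⟨(y - a) / (b - a), ⟨?_, ?_⟩, ?_⟩⟩
    · have := mul_pos hm hx.1; simp only; linarith
    · have := mul_lt_mul_of_pos_left hx.2 hm; simp only; linarith
    · exact div_pos (sub_pos.2 hy.1) hm
    · rw [div_lt_one hm]; linarith [hy.2]
    · simp only; rw [mul_div_cancel₀ _ hm.ne']; ring
  refine ⟨?_, ?_⟩
  · refine (h.1.preimage hinj.injOn).subset fun x hx => ⟨hbij.1 hx.1, ?_⟩
    have := hx.2
    rwa [Function.mem_support, hj] at this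
  · rw [indRight_comp_affine f hm, indLeft_comp_affine f hm, ← h.2,
      finsum_mem_eq_of_bijOn _ hbij fun x _ => hj x]
    simp

theorem hasIndex_cauchyIndexLt (P : R[X]) {Q : R[X]} (hQ : Q ≠ 0) (a b : R) :
    HasIndex (fracFun P Q) a b (cauchyIndexLt P Q a b) := by
  have hsub : Set.Ioo a b ∩ Function.support (jump (fracFun P Q)) ⊆
      (Q.roots.toFinset.filter fun x => a < x ∧ x < b : Finset R) := by
    rintro x ⟨hx, hx'⟩
    simp only [Finset.coe_filter, Multiset.mem_toFinset, mem_roots hQ, Set.mem_ofPred_eq]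
    refine ⟨?_, hx.1, hx.2⟩
    by_contra h
    exact hx' (by rw [jump, indRight_of_denom_ne_zero h, indLeft_of_denom_ne_zero h, sub_zero])
  refine ⟨(Finset.finite_toSet _).subset hsub, ?_⟩
  rw [cauchyIndexLt, finsum_mem_eq_sum_of_inter_support_eq]
  · rfl
  · ext x
    constructor
    · exact fun h => ⟨hsub h, h.2⟩
    · rintro ⟨h, h'⟩
      simp only [Finset.coe_filter, Set.mem_ofPred_eq] at h
      exact ⟨h.2, h'⟩

theorem hasIndex_cauchyIndex (P Q : R[X]) {a b : R} (hab : a < b) :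
    HasIndex (fracFun P Q) a b (cauchyIndex P Q a b) := by
  by_cases h : P = 0 ∨ Q = 0
  · rw [cauchyIndex, if_pos h]
    have : fracFun P Q = fun _ => (0 : R) := by
      ext x; rcases h with rfl | rfl <;> simp [fracFun]
    rw [this]
    exact hasIndex_zero a b
  · rw [cauchyIndex, if_neg h, if_pos hab]
    exact hasIndex_cauchyIndexLt P (fun h' => h (Or.inr h')) a b

theorem cauchyIndex_add (P Q : R[X]) {a b c : R} (hab : a < b) (hbc : b < c) :
    cauchyIndex P Q a c = cauchyIndex P Q a b + cauchyIndex P Q b c :=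
  (hasIndex_cauchyIndex P Q (hab.trans hbc)).unique
    ((hasIndex_cauchyIndex P Q hab).trans (hasIndex_cauchyIndex P Q hbc) hab hbc)

/-- The Cauchy index on an interval in whose interior the denominator has constant sign. -/
theorem RealClosed.cauchyIndex_eq (hR : RealClosed R) {P Q : R[X]} {a b y : R}
    (hQ : SimpleOn Q a b) (ha : Q.eval a = 0 → P.eval a ≠ 0) (hb : Q.eval b = 0 → P.eval b ≠ 0)
    (hay : a < y) (hyb : y < b) :
    cauchyIndex P Q a b = 1 / 2 * (endTerm (P.eval a) (Q.eval a) (Q.eval y)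
      - endTerm (P.eval b) (Q.eval b) (Q.eval y)) := by
  rw [← (hasIndex_cauchyIndex P Q (hay.trans hyb)).2, hR.indRight_eq hQ ha hay hyb,
    hR.indLeft_eq hQ hb hay hyb, finsum_mem_eq_zero_of_forall_eq_zero]
  · ring
  · intro x hx
    rcases hQ with rfl | hQ
    · have : fracFun P 0 = fun _ : R => (0 : R) := by ext; simp [fracFun]
      rw [this, jump, indRight_zero, indLeft_zero, sub_zero]
    · have := hQ x hx.1 hx.2
      rw [jump, indRight_of_denom_ne_zero this, indLeft_of_denom_ne_zero this, sub_zero]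

end LineIndex

end AlgIndex

namespace AlgIndex

variable {R : Type*} [Field R] [LinearOrder R] [IsStrictOrderedRing R]

/-! ### Identities for signs at the end points of a segment

Below, `p`, `q` are values at an end point of a segment and `p'`, `q'` are values at an interior
point of it; as the signs are constant inside the segment, they can only differ if the value at
the end point is `0`. -/

omit [IsStrictOrderedRing R] in
theorem sgn_cases (x : R) : x < 0 ∧ sgn x = -1 ∨ x = 0 ∧ sgn x = 0 ∨ 0 < x ∧ sgn x = 1 := by
  rcases lt_trichotomy x 0 with h | rfl | h
  · exact Or.inl ⟨h, sgn_neg h⟩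
  · exact Or.inr (Or.inl ⟨rfl, sgn_zero⟩)
  · exact Or.inr (Or.inr ⟨h, sgn_pos h⟩)

omit [IsStrictOrderedRing R] in
theorem sgn_mul_self {x : R} (h : x ≠ 0) : sgn x * sgn x = 1 := by
  rcases sgn_cases x with ⟨-, h'⟩ | ⟨h', -⟩ | ⟨-, h'⟩
  · simp [h']
  · exact absurd h' h
  · simp [h']

omit [IsStrictOrderedRing R] in
theorem ne_zero_of_sgn_ne_zero {x : R} (h : sgn x ≠ 0) : x ≠ 0 := by
  rintro rfl; exact h sgn_zero

omit [IsStrictOrderedRing R] in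
theorem sgn_ne_zero {x : R} (h : x ≠ 0) : sgn x ≠ 0 := fun h' => by
  have := sgn_mul_self h; rw [h'] at this; simp at this

omit [IsStrictOrderedRing R] in
theorem pos_of_sgn_eq {x y : R} (h : sgn x = sgn y) (hy : 0 < y) : 0 < x := by
  rw [sgn_pos hy] at h
  rcases sgn_cases x with ⟨-, h'⟩ | ⟨-, h'⟩ | ⟨h', -⟩
  · rw [h'] at h; norm_num at h
  · rw [h'] at h; norm_num at h
  · exact h'

omit [IsStrictOrderedRing R] in
theorem neg_of_sgn_eq {x y : R} (h : sgn x = sgn y) (hy : y < 0) : x < 0 := by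
  rw [sgn_neg hy] at h
  rcases sgn_cases x with ⟨h', -⟩ | ⟨-, h'⟩ | ⟨-, h'⟩
  · exact h'
  · rw [h'] at h; norm_num at h
  · rw [h'] at h; norm_num at h

/-- A polynomial identity governing the sign of a sum; it makes the correction term in the product
formula work. -/
theorem sgn_add_mul (x y : R) : sgn (x + y) * (1 + sgn x * sgn y) = sgn x + sgn y := by
  rcases sgn_cases x with ⟨h, h'⟩ | ⟨rfl, h'⟩ | ⟨h, h'⟩ <;>
  rcases sgn_cases y with ⟨k, k'⟩ | ⟨rfl, k'⟩ | ⟨k, k'⟩ <;>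
  simp only [h', k', zero_add, add_zero] <;> try norm_num
  · rw [sgn_neg (add_neg h k)]; norm_num
  · rw [sgn_pos (add_pos h k)]

/-- The sign variation `V(p, q)`. -/
def signVar (p q : R) : ℚ := |sgn p - sgn q| / 2

omit [IsStrictOrderedRing R] in
/-- The end point terms of a fraction and of its inverse. -/
theorem endTerm_add_endTerm_swap {p q p' q' : R} (hp : p ≠ 0 → sgn p' = sgn p)
    (hq : q ≠ 0 → sgn q' = sgn q) (h : q = 0 → p ≠ 0) :
    1 / 2 * (endTerm p q q' + endTerm q p p') = signVar p q - signVar p' q' := by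
  by_cases hq0 : q = 0
  · have hp0 := h hq0
    rw [endTerm, endTerm, if_pos hq0, if_neg hp0, signVar, signVar, hp hp0, hq0, sgn_zero]
    rcases sgn_cases p with ⟨-, h'⟩ | ⟨h', -⟩ | ⟨-, h'⟩
    · rcases sgn_cases q' with ⟨-, k⟩ | ⟨-, k⟩ | ⟨-, k⟩ <;> rw [h', k] <;> norm_num
    · exact absurd h' hp0
    · rcases sgn_cases q' with ⟨-, k⟩ | ⟨-, k⟩ | ⟨-, k⟩ <;> rw [h', k] <;> norm_num
  · by_cases hp0 : p = 0
    · rw [endTerm, endTerm, if_neg hq0, if_pos hp0, signVar, signVar, hq hq0, hp0, sgn_zero]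
      rcases sgn_cases q with ⟨-, h'⟩ | ⟨h', -⟩ | ⟨-, h'⟩
      · rcases sgn_cases p' with ⟨-, k⟩ | ⟨-, k⟩ | ⟨-, k⟩ <;> rw [h', k] <;> norm_num
      · exact absurd h' hq0
      · rcases sgn_cases p' with ⟨-, k⟩ | ⟨-, k⟩ | ⟨-, k⟩ <;> rw [h', k] <;> norm_num
    · rw [endTerm, endTerm, if_neg hq0, if_neg hp0, signVar, signVar, hq hq0, hp hp0]
      simp

/-- The end point terms of a product of two numbers `z = p₁ + i q₁` and `w = p₂ + i q₂`. -/
theorem endTerm_product {p₁ q₁ p₂ q₂ p₁' q₁' p₂' q₂' : R}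
    (hp₁ : p₁ ≠ 0 → sgn p₁' = sgn p₁) (hq₁ : q₁ ≠ 0 → sgn q₁' = sgn q₁)
    (hp₂ : p₂ ≠ 0 → sgn p₂' = sgn p₂) (hq₂ : q₂ ≠ 0 → sgn q₂' = sgn q₂)
    (hq₃ : p₁ * q₂ + q₁ * p₂ ≠ 0 → sgn (p₁' * q₂' + q₁' * p₂') = sgn (p₁ * q₂ + q₁ * p₂))
    (h₁ : q₁ = 0 → p₁ ≠ 0) (h₂ : q₂ = 0 → p₂ ≠ 0) :
    endTerm (p₁ * p₂ - q₁ * q₂) (p₁ * q₂ + q₁ * p₂) (p₁' * q₂' + q₁' * p₂') =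
      endTerm p₁ q₁ q₁' + endTerm p₂ q₂ q₂'
        - (sgn q₁' * sgn q₂' * sgn (p₁' * q₂' + q₁' * p₂')
          - sgn q₁ * sgn q₂ * sgn (p₁ * q₂ + q₁ * p₂)) := by
  by_cases z₁ : q₁ = 0 <;> by_cases z₂ : q₂ = 0
  · have h := sgn_add_mul (p₁' * q₂') (q₁' * p₂')
    subst z₁ z₂
    have e₁ := sgn_mul_self (h₁ rfl)
    have e₂ := sgn_mul_self (h₂ rfl)
    simp only [endTerm, mul_zero, zero_mul, add_zero, sub_zero, if_true, sgn_mul, sgn_zero,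
      hp₁ (h₁ rfl), hp₂ (h₂ rfl)] at h ⊢
    set u := sgn (p₁' * q₂' + q₁' * p₂')
    linear_combination (sgn p₁ * sgn p₂) * h + sgn q₁' * sgn p₁ * e₂ + sgn q₂' * sgn p₂ * e₁
      - u * sgn q₁' * sgn q₂' * (e₁ * sgn p₂ * sgn p₂ + e₂)
  · subst z₁
    have e₂ := sgn_mul_self z₂
    have h3 : p₁ * q₂ + 0 * p₂ ≠ 0 := by simpa using ⟨h₁ rfl, z₂⟩
    rw [hq₃ h3, hq₂ z₂, endTerm, if_neg h3, endTerm, if_pos rfl, endTerm, if_neg z₂]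
    simp only [zero_mul, add_zero, sgn_mul, sgn_zero]
    linear_combination sgn p₁ * sgn q₁' * e₂
  · subst z₂
    have e₁ := sgn_mul_self z₁
    have h3 : p₁ * 0 + q₁ * p₂ ≠ 0 := by simpa using ⟨z₁, h₂ rfl⟩
    rw [hq₃ h3, hq₁ z₁, endTerm, if_neg h3, endTerm, if_neg z₁, endTerm, if_pos rfl]
    simp only [mul_zero, zero_add, sgn_mul, sgn_zero]
    linear_combination sgn p₂ * sgn q₂' * e₁
  · rw [hq₁ z₁, hq₂ z₂, endTerm.eq_def p₁, if_neg z₁, endTerm.eq_def p₂, if_neg z₂]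
    by_cases z₃ : p₁ * q₂ + q₁ * p₂ = 0
    · rw [endTerm, if_pos z₃, z₃]
      have h : sgn (p₁ * p₂ - q₁ * q₂) * sgn q₂ = -sgn q₁ := by
        rw [← sgn_mul, show (p₁ * p₂ - q₁ * q₂) * q₂ = -(q₁ * (p₂ ^ 2 + q₂ ^ 2)) by
          linear_combination p₂ * z₃, sgn_neg_eq, sgn_mul,
          sgn_pos (by positivity : 0 < p₂ ^ 2 + q₂ ^ 2), mul_one]
      have e₂ := sgn_mul_self z₂
      rw [sgn_zero]
      linear_combination sgn (p₁' * q₂' + q₁' * p₂') * (sgn q₂ * h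
        - sgn (p₁ * p₂ - q₁ * q₂) * e₂)
    · rw [endTerm, if_neg z₃, hq₃ z₃]; ring

/-- A coarse angle of `p + i q`, in full turns: exact on the coordinate axes, except that all points
of an open half plane `q > 0` or `q < 0` get the angle of its middle ray. -/
def turn (p q : R) : ℚ :=
  if 0 < q then 1 / 4 else if q < 0 then 3 / 4 else if 0 < p then 0 else 1 / 2

omit [IsStrictOrderedRing R] in
theorem endTerm_turn {p q p' q' : R} (hp : p ≠ 0 → sgn p' = sgn p)
    (hq : q ≠ 0 → sgn q' = sgn q) (h : q = 0 → p ≠ 0) :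
    ∃ m : ℤ, 1 / 4 * endTerm p q q' = turn p' q' - turn p q + m := by
  rcases lt_trichotomy q 0 with hq0 | hq0 | hq0
  · have := neg_of_sgn_eq (hq hq0.ne) hq0
    exact ⟨0, by simp [endTerm, turn, hq0.ne, hq0, this, not_lt_of_gt]⟩
  · have hp0 := h hq0
    subst hq0
    rcases lt_or_gt_of_ne hp0 with hp1 | hp1
    · have hp' := neg_of_sgn_eq (hp hp0) hp1
      rcases sgn_cases q' with ⟨k, k'⟩ | ⟨k, k'⟩ | ⟨k, k'⟩
      · exact ⟨0, by simp [endTerm, turn, k', k, k.not_gt, sgn_neg hp1, hp1.not_gt]; norm_num⟩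
      · exact ⟨0, by simp [endTerm, turn, k, hp1.not_gt, hp'.not_gt]⟩
      · exact ⟨0, by simp [endTerm, turn, k', k, sgn_neg hp1, hp1.not_gt]; norm_num⟩
    · have hp' := pos_of_sgn_eq (hp hp0) hp1
      rcases sgn_cases q' with ⟨k, k'⟩ | ⟨k, k'⟩ | ⟨k, k'⟩
      · exact ⟨-1, by simp [endTerm, turn, k', k, k.not_gt, sgn_pos hp1, hp1]; norm_num⟩
      · exact ⟨0, by simp [endTerm, turn, k, hp1, hp']⟩
      · exact ⟨0, by simp [endTerm, turn, k', k, sgn_pos hp1, hp1]⟩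
  · have := pos_of_sgn_eq (hq hq0.ne') hq0
    exact ⟨0, by simp [endTerm, turn, hq0.ne', hq0, this]⟩

/-! ### The calculus of Cauchy indices -/

/-- `P` and `Q` have no common zero in `[a,b]`. -/
def NoCommonZero (P Q : R[X]) (a b : R) : Prop :=
  ∀ x, a ≤ x → x ≤ b → Q.eval x = 0 → P.eval x ≠ 0

omit [IsStrictOrderedRing R] in
theorem NoCommonZero.swap {P Q : R[X]} {a b : R} (h : NoCommonZero P Q a b) :
    NoCommonZero Q P a b := fun x h1 h2 h3 h4 => h x h1 h2 h4 h3

omit [IsStrictOrderedRing R] in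
/-- Reduction of a statement about intervals to intervals on which finitely many given polynomials
have constant sign. -/
theorem simpleOn_induction (S : Finset R[X]) {Φ : R → R → Prop} {a b : R}
    (htrans : ∀ c d e, a ≤ c → c < d → d < e → e ≤ b → Φ c d → Φ d e → Φ c e)
    (hS : ∀ c d, a ≤ c → c < d → d ≤ b → (∀ P ∈ S, SimpleOn P c d) → Φ c d) (hab : a < b) :
    Φ a b := by
  classical
  refine interval_induction (S.biUnion fun P => P.roots.toFinset) htrans
    (fun c d hac hcd hdb hE => hS c d hac hcd hdb fun P hP => simpleOn_of_roots fun x hx => ?_) hab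
  exact hE x (Finset.mem_biUnion.2 ⟨P, hP, hx⟩)

theorem RealClosed.sgn_left (hR : RealClosed R) {P : R[X]} {a b y : R} (h : SimpleOn P a b)
    (hay : a < y) (hyb : y < b) (ha : P.eval a ≠ 0) : sgn (P.eval y) = sgn (P.eval a) :=
  sgn_congr (hR.sign_left h ha hay hyb)

theorem RealClosed.sgn_right (hR : RealClosed R) {P : R[X]} {a b y : R} (h : SimpleOn P a b)
    (hay : a < y) (hyb : y < b) (hb : P.eval b ≠ 0) : sgn (P.eval y) = sgn (P.eval b) :=
  sgn_congr (hR.sign_right h hb hay hyb)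

/-- The Cauchy index of `P / Q` only depends on the signs of `P` at the zeros of `Q`. -/
theorem RealClosed.cauchyIndex_eq_mul (hR : RealClosed R) {P P' Q : R[X]} {a b : R} (hab : a < b)
    (h : NoCommonZero P Q a b) {ε : ℚ} (hε : ε ≠ 0)
    (hP : ∀ x, a ≤ x → x ≤ b → Q.eval x = 0 → sgn (P'.eval x) = ε * sgn (P.eval x)) :
    cauchyIndex P' Q a b = ε * cauchyIndex P Q a b := by
  have h' : NoCommonZero P' Q a b := fun x h1 h2 h3 => ne_zero_of_sgn_ne_zero (by
    rw [hP x h1 h2 h3]; exact mul_ne_zero hε (sgn_ne_zero (h x h1 h2 h3)))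
  refine simpleOn_induction {Q} (Φ := fun c d => cauchyIndex P' Q c d = ε * cauchyIndex P Q c d)
    ?_ ?_ hab
  · intro c d e _ hcd hde _ h1 h2
    rw [cauchyIndex_add _ _ hcd hde, cauchyIndex_add _ _ hcd hde, h1, h2, mul_add]
  · intro c d hac hcd hdb hS
    obtain ⟨y, hcy, hyd⟩ := exists_between hcd
    have hQ := hS Q (by simp)
    have key : ∀ x, a ≤ x → x ≤ b → endTerm (P'.eval x) (Q.eval x) (Q.eval y) =
        ε * endTerm (P.eval x) (Q.eval x) (Q.eval y) := by
      intro x h1 h2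
      by_cases h3 : Q.eval x = 0
      · rw [endTerm, endTerm, if_pos h3, if_pos h3, hP x h1 h2 h3, mul_assoc]
      · rw [endTerm, endTerm, if_neg h3, if_neg h3, mul_zero]
    have hcb := hcd.le.trans hdb
    have had := hac.trans hcd.le
    rw [hR.cauchyIndex_eq hQ (h' c hac hcb) (h' d had hdb) hcy hyd,
      hR.cauchyIndex_eq hQ (h c hac hcb) (h d had hdb) hcy hyd, key c hac hcb, key d had hdb]
    ring

/-- The inversion formula for Cauchy indices. -/
theorem RealClosed.cauchyIndex_add_swap (hR : RealClosed R) {P Q : R[X]} {a b : R} (hab : a < b)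
    (h : NoCommonZero P Q a b) :
    cauchyIndex P Q a b + cauchyIndex Q P a b =
      signVar (P.eval a) (Q.eval a) - signVar (P.eval b) (Q.eval b) := by
  classical
  refine simpleOn_induction {P, Q} (Φ := fun a b => cauchyIndex P Q a b + cauchyIndex Q P a b =
      signVar (P.eval a) (Q.eval a) - signVar (P.eval b) (Q.eval b)) ?_ ?_ hab
  · intro c d e _ hcd hde _ h1 h2
    rw [cauchyIndex_add _ _ hcd hde, cauchyIndex_add _ _ hcd hde]
    linear_combination h1 + h2
  · intro c d hac hcd hdb hS
    obtain ⟨y, hcy, hyd⟩ := exists_between hcd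
    have hP := hS P (by simp)
    have hQ := hS Q (by simp)
    have hcb := hcd.le.trans hdb
    have had := hac.trans hcd.le
    rw [hR.cauchyIndex_eq hQ (h c hac hcb) (h d had hdb) hcy hyd,
      hR.cauchyIndex_eq hP (h.swap c hac hcb) (h.swap d had hdb) hcy hyd]
    linear_combination endTerm_add_endTerm_swap (hR.sgn_left hP hcy hyd) (hR.sgn_left hQ hcy hyd)
      (h c hac hcb) - endTerm_add_endTerm_swap (hR.sgn_right hP hcy hyd)
      (hR.sgn_right hQ hcy hyd) (h d had hdb)

theorem RealClosed.cauchyIndex_of_denom_ne_zero (hR : RealClosed R) {P Q : R[X]} {a b : R}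
    (hab : a < b) (h : ∀ x, a ≤ x → x ≤ b → Q.eval x ≠ 0) : cauchyIndex P Q a b = 0 := by
  obtain ⟨y, hay, hyb⟩ := exists_between hab
  have ha := h a le_rfl hab.le
  have hb := h b hab.le le_rfl
  rw [hR.cauchyIndex_eq (.of_le h le_rfl le_rfl) (fun h => absurd h ha) (fun h => absurd h hb)
    hay hyb, endTerm, endTerm, if_neg ha, if_neg hb]
  norm_num

/-- The Cauchy index of a path that stays in one of the half planes `re z > 0`, `re z < 0`. -/
theorem RealClosed.cauchyIndex_of_num_ne_zero (hR : RealClosed R) {P Q : R[X]} {a b : R}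
    (hab : a < b) (h : ∀ x, a ≤ x → x ≤ b → P.eval x ≠ 0) :
    cauchyIndex P Q a b = sgn (P.eval a) * (sgn (Q.eval b) - sgn (Q.eval a)) / 2 := by
  have h1 := hR.cauchyIndex_add_swap (Q := Q) hab fun x h1 h2 _ => h x h1 h2
  rw [hR.cauchyIndex_of_denom_ne_zero hab h, add_zero] at h1
  rw [h1, signVar, signVar, sgn_congr (hR.sign_eq_of_forall_ne hab.le h)]
  rcases sgn_cases (P.eval b) with ⟨-, h'⟩ | ⟨h', -⟩ | ⟨-, h'⟩
  · rcases sgn_cases (Q.eval a) with ⟨-, k⟩ | ⟨-, k⟩ | ⟨-, k⟩ <;>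
    rcases sgn_cases (Q.eval b) with ⟨-, l⟩ | ⟨-, l⟩ | ⟨-, l⟩ <;> rw [h', k, l] <;> norm_num
  · exact absurd h' (h b hab.le le_rfl)
  · rcases sgn_cases (Q.eval a) with ⟨-, k⟩ | ⟨-, k⟩ | ⟨-, k⟩ <;>
    rcases sgn_cases (Q.eval b) with ⟨-, l⟩ | ⟨-, l⟩ | ⟨-, l⟩ <;> rw [h', k, l] <;> norm_num

/-- The correction term in the product formula: for `z = p₁ + i q₁` and `w = p₂ + i q₂`, the
product of the signs of the imaginary parts of `z`, `w` and `z w`. -/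
def prodTerm (p₁ q₁ p₂ q₂ : R) : ℚ := sgn q₁ * sgn q₂ * sgn (p₁ * q₂ + q₁ * p₂)

/-- The product formula for Cauchy indices. -/
theorem RealClosed.cauchyIndex_product (hR : RealClosed R) {P₁ Q₁ P₂ Q₂ : R[X]} {a b : R}
    (hab : a < b) (h₁ : NoCommonZero P₁ Q₁ a b) (h₂ : NoCommonZero P₂ Q₂ a b) :
    cauchyIndex (P₁ * P₂ - Q₁ * Q₂) (P₁ * Q₂ + Q₁ * P₂) a b =
      cauchyIndex P₁ Q₁ a b + cauchyIndex P₂ Q₂ a b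
        + 1 / 2 * (prodTerm (P₁.eval a) (Q₁.eval a) (P₂.eval a) (Q₂.eval a)
          - prodTerm (P₁.eval b) (Q₁.eval b) (P₂.eval b) (Q₂.eval b)) := by
  classical
  refine simpleOn_induction {P₁, Q₁, P₂, Q₂, P₁ * Q₂ + Q₁ * P₂}
    (Φ := fun a b => cauchyIndex (P₁ * P₂ - Q₁ * Q₂) (P₁ * Q₂ + Q₁ * P₂) a b =
      cauchyIndex P₁ Q₁ a b + cauchyIndex P₂ Q₂ a b
        + 1 / 2 * (prodTerm (P₁.eval a) (Q₁.eval a) (P₂.eval a) (Q₂.eval a)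
          - prodTerm (P₁.eval b) (Q₁.eval b) (P₂.eval b) (Q₂.eval b))) ?_ ?_ hab
  · intro c d e _ hcd hde _ h1 h2
    rw [cauchyIndex_add _ _ hcd hde, cauchyIndex_add _ _ hcd hde, cauchyIndex_add _ _ hcd hde]
    linear_combination h1 + h2
  · intro c d hac hcd hdb hS
    obtain ⟨y, hcy, hyd⟩ := exists_between hcd
    have hP₁ := hS P₁ (by simp)
    have hQ₁ := hS Q₁ (by simp)
    have hP₂ := hS P₂ (by simp)
    have hQ₂ := hS Q₂ (by simp)
    have hQ₃ := hS (P₁ * Q₂ + Q₁ * P₂) (by simp)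
    have hcb := hcd.le.trans hdb
    have had := hac.trans hcd.le
    have h₃ : NoCommonZero (P₁ * P₂ - Q₁ * Q₂) (P₁ * Q₂ + Q₁ * P₂) a b := by
      intro x hx1 hx2 h3 h4
      simp only [eval_add, eval_sub, eval_mul] at h3 h4
      have h5 : ((P₁.eval x) ^ 2 + (Q₁.eval x) ^ 2) * ((P₂.eval x) ^ 2 + (Q₂.eval x) ^ 2) = 0 := by
        linear_combination (P₁.eval x * P₂.eval x - Q₁.eval x * Q₂.eval x) * h4
          + (P₁.eval x * Q₂.eval x + Q₁.eval x * P₂.eval x) * h3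
      have hz : ∀ {P Q : R[X]}, NoCommonZero P Q a b → (P.eval x) ^ 2 + (Q.eval x) ^ 2 ≠ 0 := by
        intro P Q h
        by_cases hq : Q.eval x = 0
        · have := h x hx1 hx2 hq
          positivity
        · positivity
      exact mul_ne_zero (hz h₁) (hz h₂) h5
    have key₁ := hR.sgn_left hQ₃ hcy hyd
    have key₂ := hR.sgn_right hQ₃ hcy hyd
    rw [hR.cauchyIndex_eq hQ₃ (h₃ c hac hcb) (h₃ d had hdb) hcy hyd,
      hR.cauchyIndex_eq hQ₁ (h₁ c hac hcb) (h₁ d had hdb) hcy hyd,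
      hR.cauchyIndex_eq hQ₂ (h₂ c hac hcb) (h₂ d had hdb) hcy hyd]
    simp only [eval_add, eval_sub, eval_mul, prodTerm] at key₁ key₂ ⊢
    linear_combination 1 / 2 * endTerm_product (hR.sgn_left hP₁ hcy hyd)
      (hR.sgn_left hQ₁ hcy hyd) (hR.sgn_left hP₂ hcy hyd) (hR.sgn_left hQ₂ hcy hyd) key₁
      (h₁ c hac hcb) (h₂ c hac hcb) - 1 / 2 * endTerm_product (hR.sgn_right hP₁ hcy hyd)
      (hR.sgn_right hQ₁ hcy hyd) (hR.sgn_right hP₂ hcy hyd) (hR.sgn_right hQ₂ hcy hyd) key₂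
      (h₁ d had hdb) (h₂ d had hdb)

/-- Modulo full turns, half the Cauchy index is the difference of the coarse angles. -/
theorem RealClosed.cauchyIndex_turn (hR : RealClosed R) {P Q : R[X]} {a b : R} (hab : a < b)
    (h : NoCommonZero P Q a b) :
    ∃ m : ℤ, 1 / 2 * cauchyIndex P Q a b =
      turn (P.eval b) (Q.eval b) - turn (P.eval a) (Q.eval a) + m := by
  classical
  refine simpleOn_induction {P, Q} (Φ := fun a b => ∃ m : ℤ, 1 / 2 * cauchyIndex P Q a b =
      turn (P.eval b) (Q.eval b) - turn (P.eval a) (Q.eval a) + m) ?_ ?_ hab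
  · rintro c d e _ hcd hde _ ⟨m, hm⟩ ⟨n, hn⟩
    refine ⟨m + n, ?_⟩
    rw [cauchyIndex_add _ _ hcd hde]
    push_cast
    linear_combination hm + hn
  · intro c d hac hcd hdb hS
    obtain ⟨y, hcy, hyd⟩ := exists_between hcd
    have hP := hS P (by simp)
    have hQ := hS Q (by simp)
    have hcb := hcd.le.trans hdb
    have had := hac.trans hcd.le
    obtain ⟨m, hm⟩ := endTerm_turn (hR.sgn_left hP hcy hyd) (hR.sgn_left hQ hcy hyd) (h c hac hcb)
    obtain ⟨n, hn⟩ := endTerm_turn (hR.sgn_right hP hcy hyd) (hR.sgn_right hQ hcy hyd)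
      (h d had hdb)
    refine ⟨m - n, ?_⟩
    rw [hR.cauchyIndex_eq hQ (h c hac hcb) (h d had hdb) hcy hyd]
    push_cast
    linear_combination hm - hn

/-! ### Sturm's theorem -/

/-- The Cauchy index as a difference of sign variations along the sequence of remainders, before
division by the greatest common divisor. -/
theorem RealClosed.cauchyIndex_eq_euclidSeq (hR : RealClosed R) {a b : R} (hab : a < b) (D N : R[X])
    (h : NoCommonZero N D a b) :
    cauchyIndex N D a b = signChangesDiff (euclidSeq D N) a b := by
  induction D, N using euclidSeq.induct with
  | case1 D => rw [euclidSeq, dif_pos rfl]; simp [cauchyIndex, signChangesDiff, signChanges]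
  | case2 D N hN ih =>
    have hD : ∀ x, D.eval x = N.eval x * (D / N).eval x + (D % N).eval x := fun x => by
      rw [← eval_mul, ← eval_add, EuclideanDomain.div_add_mod]
    have h' : NoCommonZero (-(D % N)) N a b := fun x h1 h2 h3 h4 => h.swap x h1 h2 h3 (by
      rw [hD, h3]; simpa using h4)
    have e1 := hR.cauchyIndex_add_swap hab h
    have e2 : cauchyIndex D N a b = -1 * cauchyIndex (-(D % N)) N a b :=
      hR.cauchyIndex_eq_mul hab h' (by norm_num) fun x _ _ h3 => by
        rw [hD, h3, eval_neg, sgn_neg_eq]; simp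
    have e3 : ∃ l, euclidSeq N (-(D % N)) = N :: l := by
      rw [euclidSeq]; split_ifs <;> exact ⟨_, rfl⟩
    obtain ⟨l, hl⟩ := e3
    have ih := ih h'
    rw [euclidSeq, dif_neg hN]
    rw [hl] at ih ⊢
    simp only [signChangesDiff, List.map_cons, signChanges] at ih ⊢
    simp only [signVar, sgn] at e1
    rw [abs_sub_comm (_ : ℚ) ((SignType.sign (eval a D) : SignType) : ℚ),
      abs_sub_comm (_ : ℚ) ((SignType.sign (eval b D) : SignType) : ℚ)] at e1
    linear_combination e1 - e2 + ih

theorem signChanges_map_mul {l l' : List R} {c : R} (hc : c ≠ 0)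
    (h : l = l'.map fun x => x * c) : signChanges l = signChanges l' := by
  subst h
  induction l' with
  | nil => rfl
  | cons x l ih =>
    cases l with
    | nil => rfl
    | cons y l =>
      simp only [List.map_cons, signChanges] at ih ⊢
      rw [ih, sign_mul, sign_mul, SignType.coe_mul, SignType.coe_mul, ← sub_mul, abs_mul]
      have : |((SignType.sign c : SignType) : ℚ)| = 1 := by
        rcases lt_or_gt_of_ne hc with h | h
        · simp [sign_neg h]
        · simp [sign_pos h]
      rw [this, mul_one]

omit [LinearOrder R] [IsStrictOrderedRing R] in
/-- The last term of the sequence of remainders divides all terms. -/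
theorem getLastD_euclidSeq_dvd (D N : R[X]) :
    ∀ P ∈ euclidSeq D N, (euclidSeq D N).getLastD 1 ∣ P := by
  induction D, N using euclidSeq.induct with
  | case1 D => rw [euclidSeq, dif_pos rfl]; simp
  | case2 D N hN ih =>
    obtain ⟨l, hl⟩ : ∃ l, euclidSeq N (-(D % N)) = N :: l := by
      rw [euclidSeq]; split_ifs <;> exact ⟨_, rfl⟩
    have hlast : (euclidSeq D N).getLastD 1 = (euclidSeq N (-(D % N))).getLastD 1 := by
      rw [euclidSeq, dif_neg hN, hl]; simp
    have hN' := ih N (by simp [hl])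
    have hmod : (euclidSeq N (-(D % N))).getLastD 1 ∣ D % N := by
      by_cases h0 : D % N = 0
      · simp [h0]
      · rw [← dvd_neg]
        refine ih _ ?_
        rw [euclidSeq, dif_neg (neg_ne_zero.2 h0), euclidSeq]
        split_ifs <;> simp
    intro P hP
    rw [hlast]
    rw [euclidSeq, dif_neg hN, List.mem_cons] at hP
    rcases hP with rfl | hP
    · have := dvd_add (hN'.mul_right (P / N)) hmod
      rwa [EuclideanDomain.div_add_mod] at this
    · exact ih P hP

/-- Sturm's theorem for fractions without common zeros. -/
theorem RealClosed.cauchyIndex_eq_sturmIndex (hR : RealClosed R) {N D : R[X]} {a b : R}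
    (hab : a < b) (h : NoCommonZero N D a b) : cauchyIndex N D a b = sturmIndex N D a b := by
  rw [sturmIndex, sturmChain]
  split_ifs with hN
  · simp [cauchyIndex, hN, signChangesDiff, signChanges]
  rw [hR.cauchyIndex_eq_euclidSeq hab D N h]
  set L := (euclidSeq D N).getLastD 1 with hL
  have hdvd := getLastD_euclidSeq_dvd D N
  have hDm : D ∈ euclidSeq D N := by rw [euclidSeq, dif_neg hN]; simp
  have hNm : N ∈ euclidSeq D N := by
    rw [euclidSeq, dif_neg hN, euclidSeq]; split_ifs <;> simp
  have hLx : ∀ x, a ≤ x → x ≤ b → L.eval x ≠ 0 := fun x h1 h2 h3 =>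
    h x h1 h2 (eval_eq_zero_of_dvd_of_eval_eq_zero (hdvd D hDm) h3)
      (eval_eq_zero_of_dvd_of_eval_eq_zero (hdvd N hNm) h3)
  have key : ∀ x, a ≤ x → x ≤ b → signChanges ((euclidSeq D N).map fun P => P.eval x) =
      signChanges (((euclidSeq D N).map fun P => P / L).map fun P => P.eval x) := by
    intro x h1 h2
    refine signChanges_map_mul (hLx x h1 h2) ?_
    rw [List.map_map, List.map_map]
    refine List.map_congr_left fun P hP => ?_
    simp only [Function.comp]
    rw [← eval_mul, mul_comm, EuclideanDomain.mul_div_cancel' _ (hdvd P hP)]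
    rintro h0
    exact hLx a le_rfl hab.le (by rw [hL, h0]; simp)
  rw [signChangesDiff, signChangesDiff, key a le_rfl hab.le, key b hab.le le_rfl]

end AlgIndex

namespace AlgIndex

variable {R : Type*} [Field R]

/-! ### Polynomials in two variables on a rectangle -/

/-- The polynomial `t ↦ P(s, t)`. -/
noncomputable def row (P : R[X][X]) (s : R) : R[X] := P.map (evalRingHom s)

/-- The polynomial `s ↦ P(s, t)`. -/
noncomputable def col (P : R[X][X]) (t : R) : R[X] := P.eval (C t)

@[simp] theorem eval_row (P : R[X][X]) (s t : R) : (row P s).eval t = P.evalEval s t :=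
  map_evalRingHom_eval s t P

@[simp] theorem eval_col (P : R[X][X]) (s t : R) : (col P t).eval s = P.evalEval s t := rfl

/-- Pseudo-division of polynomials over a domain. -/
theorem exists_pseudo_div {A : Type*} [CommRing A] [IsDomain A] (P : A[X]) {Q : A[X]} (hQ : Q ≠ 0) :
    ∃ (k : ℕ) (T S : A[X]), C (Q.leadingCoeff ^ k) * P = T * Q + S ∧ S.degree < Q.degree := by
  induction hd : P.degree using WellFoundedLT.induction generalizing P with
  | ind d ih =>
  subst hd
  by_cases h : P.degree < Q.degree
  · exact ⟨0, 0, P, by simp, h⟩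
  rw [not_lt] at h
  have hP : P ≠ 0 := by
    rintro rfl
    rw [degree_zero, le_bot_iff, degree_eq_bot] at h
    exact hQ h
  have hn : Q.natDegree ≤ P.natDegree := natDegree_le_natDegree h
  have hlQ : Q.leadingCoeff ≠ 0 := leadingCoeff_ne_zero.2 hQ
  have hlP : P.leadingCoeff ≠ 0 := leadingCoeff_ne_zero.2 hP
  set M := C P.leadingCoeff * X ^ (P.natDegree - Q.natDegree) with hM
  have hlt : (C Q.leadingCoeff * P - M * Q).degree < P.degree := by
    have h1 : (C Q.leadingCoeff * P).degree = P.degree := degree_C_mul hlQ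
    rw [← h1]
    refine degree_sub_lt_left ?_ (mul_ne_zero (C_ne_zero.2 hlQ) hP) ?_
    · rw [h1, degree_mul, hM, degree_C_mul_X_pow _ hlP, degree_eq_natDegree hQ,
        degree_eq_natDegree hP, ← Nat.cast_add, Nat.sub_add_cancel hn]
    · rw [leadingCoeff_mul, leadingCoeff_C, leadingCoeff_mul, hM, leadingCoeff_C_mul_X_pow,
        mul_comm]
  obtain ⟨k, T, S, h1, h2⟩ := ih _ hlt _ rfl
  refine ⟨k + 1, T + C (Q.leadingCoeff ^ k) * M, S, ?_, h2⟩
  rw [pow_succ, C_mul]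
  linear_combination h1

variable [LinearOrder R]

/-- Twice the index along the boundary of `[s,s'] × [t,t']` of the map `(P, Q)`, where the boundary
runs from `(s,t)` to `(s,t')`, `(s',t')`, `(s',t)` and back. -/
noncomputable def boundaryIndex (P Q : R[X][X]) (s s' t t' : R) : ℚ :=
  cauchyIndex (row P s) (row Q s) t t' + cauchyIndex (col P t') (col Q t') s s'
    - cauchyIndex (row P s') (row Q s') t t' - cauchyIndex (col P t) (col Q t) s s'

variable [IsStrictOrderedRing R]

theorem boundaryIndex_add_left (P Q : R[X][X]) {s s' s'' : R} (t t' : R) (h : s < s')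
    (h' : s' < s'') : boundaryIndex P Q s s'' t t' =
      boundaryIndex P Q s s' t t' + boundaryIndex P Q s' s'' t t' := by
  rw [boundaryIndex, cauchyIndex_add _ _ h h', cauchyIndex_add _ _ h h', boundaryIndex,
    boundaryIndex]
  ring

theorem boundaryIndex_add_right (P Q : R[X][X]) (s s' : R) {t t' t'' : R} (h : t < t')
    (h' : t' < t'') : boundaryIndex P Q s s' t t'' =
      boundaryIndex P Q s s' t t' + boundaryIndex P Q s s' t' t'' := by
  rw [boundaryIndex, cauchyIndex_add _ _ h h', cauchyIndex_add _ _ h h', boundaryIndex,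
    boundaryIndex]
  ring

theorem RealClosed.boundaryIndex_of_denom_ne_zero (hR : RealClosed R) {P Q : R[X][X]}
    {s s' t t' : R} (hs : s < s') (ht : t < t')
    (h : ∀ x y, s ≤ x → x ≤ s' → t ≤ y → y ≤ t' → Q.evalEval x y ≠ 0) :
    boundaryIndex P Q s s' t t' = 0 := by
  have hrow : ∀ x, s ≤ x → x ≤ s' → cauchyIndex (row P x) (row Q x) t t' = 0 := fun x h1 h2 =>
    hR.cauchyIndex_of_denom_ne_zero ht fun y h3 h4 => by simpa using h x y h1 h2 h3 h4
  have hcol : ∀ y, t ≤ y → y ≤ t' → cauchyIndex (col P y) (col Q y) s s' = 0 := fun y h3 h4 =>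
    hR.cauchyIndex_of_denom_ne_zero hs fun x h1 h2 => by simpa using h x y h1 h2 h3 h4
  rw [boundaryIndex, hrow s le_rfl hs.le, hrow s' hs.le le_rfl, hcol t le_rfl ht.le,
    hcol t' ht.le le_rfl]
  norm_num

theorem RealClosed.boundaryIndex_of_sgn_num (hR : RealClosed R) {P Q : R[X][X]}
    {s s' t t' : R} (hs : s < s') (ht : t < t') {e : ℚ} (he : e ≠ 0)
    (h : ∀ x y, s ≤ x → x ≤ s' → t ≤ y → y ≤ t' → sgn (P.evalEval x y) = e) :
    boundaryIndex P Q s s' t t' = 0 := by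
  have hne : ∀ x y, s ≤ x → x ≤ s' → t ≤ y → y ≤ t' → P.evalEval x y ≠ 0 :=
    fun x y h1 h2 h3 h4 => ne_zero_of_sgn_ne_zero (by rwa [h x y h1 h2 h3 h4])
  have hrow : ∀ x, s ≤ x → x ≤ s' → cauchyIndex (row P x) (row Q x) t t' =
      e * (sgn (Q.evalEval x t') - sgn (Q.evalEval x t)) / 2 := fun x h1 h2 => by
    rw [hR.cauchyIndex_of_num_ne_zero ht fun y h3 h4 => by simpa using hne x y h1 h2 h3 h4]
    simp [h x t h1 h2 le_rfl ht.le]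
  have hcol : ∀ y, t ≤ y → y ≤ t' → cauchyIndex (col P y) (col Q y) s s' =
      e * (sgn (Q.evalEval s' y) - sgn (Q.evalEval s y)) / 2 := fun y h3 h4 => by
    rw [hR.cauchyIndex_of_num_ne_zero hs fun x h1 h2 => by simpa using hne x y h1 h2 h3 h4]
    simp [h s y le_rfl hs.le h3 h4]
  rw [boundaryIndex, hrow s le_rfl hs.le, hrow s' hs.le le_rfl, hcol t le_rfl ht.le,
    hcol t' ht.le le_rfl]
  ring

open Filter Topology in
/-- Polynomials in two variables depend continuously on the first variable, uniformly in the
second variable on bounded intervals. -/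
theorem exists_abs_evalEval_sub_lt (P : R[X][X]) (s₀ c d : R) {δ : R} (hδ : 0 < δ) :
    ∃ ε > 0, ∀ s, |s - s₀| < ε → ∀ t, c ≤ t → t ≤ d →
      |P.evalEval s t - P.evalEval s₀ t| < δ := by
  let _ : TopologicalSpace R := Preorder.topology R
  have : OrderTopology R := ⟨rfl⟩
  set T := max |c| |d|
  set g : R → R := fun s => ∑ i ∈ P.support, |(P.coeff i).eval s - (P.coeff i).eval s₀| * T ^ i
    with hg
  have hcont : Continuous g := by
    refine continuous_finsetSum _ fun i _ => Continuous.mul ?_ continuous_const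
    exact ((P.coeff i).continuous.sub continuous_const).abs
  have h0 : g s₀ = 0 := by simp [hg]
  have hev : ∀ᶠ s in 𝓝 s₀, g s < δ := hcont.continuousAt.eventually_lt_const (by rwa [h0])
  obtain ⟨ε, hε, h⟩ := (nhds_basis_abs_sub_lt s₀).eventually_iff.1 hev
  refine ⟨ε, hε, fun s hs t hct htd => lt_of_le_of_lt ?_ (h hs)⟩
  have hT : |t| ≤ T := by
    refine abs_le.2 ⟨?_, htd.trans ((le_abs_self d).trans (le_max_right _ _))⟩
    exact (neg_le_neg (le_max_left _ _)).trans ((neg_abs_le c).trans hct)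
  have hexp : ∀ s, P.evalEval s t = ∑ i ∈ P.support, (P.coeff i).eval s * t ^ i := fun s => by
    rw [evalEval, eval_eq_sum (p := P), Polynomial.sum, eval_finsetSum]
    simp
  rw [hexp, hexp, ← Finset.sum_sub_distrib]
  refine (Finset.abs_sum_le_sum_abs _ _).trans (Finset.sum_le_sum fun i _ => ?_)
  rw [← sub_mul, abs_mul, abs_pow]
  gcongr

/-- If `P` has no zero on `{s₀} × [c,d]`, then its sign is constant on a neighbourhood. -/
theorem RealClosed.exists_sgn_evalEval_eq (hR : RealClosed R) (P : R[X][X]) {s₀ c d : R}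
    (hcd : c < d) (h : ∀ t, c ≤ t → t ≤ d → P.evalEval s₀ t ≠ 0) :
    ∃ ε > 0, ∀ s, |s - s₀| < ε → ∀ t, c ≤ t → t ≤ d →
      sgn (P.evalEval s t) = sgn (P.evalEval s₀ c) := by
  have pos : ∀ P : R[X][X], (∀ t, c ≤ t → t ≤ d → 0 < P.evalEval s₀ t) →
      ∃ ε > 0, ∀ s, |s - s₀| < ε → ∀ t, c ≤ t → t ≤ d → 0 < P.evalEval s t := by
    intro P hP
    obtain ⟨δ, hδ, h1⟩ := hR.exists_pos_le_eval (P := row P s₀) hcd (by simpa using hP)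
    obtain ⟨ε, hε, h2⟩ := exists_abs_evalEval_sub_lt P s₀ c d hδ
    refine ⟨ε, hε, fun s hs t hct htd => ?_⟩
    have h3 := h1 t hct htd
    rw [eval_row] at h3
    have h4 := (abs_lt.1 (h2 s hs t hct htd)).1
    linarith
  have hsgn : ∀ t, c ≤ t → t ≤ d → sgn (P.evalEval s₀ t) = sgn (P.evalEval s₀ c) := by
    intro t hct htd
    have := hR.sign_eq_of_forall_ne (P := row P s₀) hct
      fun x h1 h2 => by simpa using h x h1 (h2.trans htd)
    simpa using (sgn_congr this).symm
  rcases lt_or_gt_of_ne (h c le_rfl hcd.le) with h0 | h0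
  · obtain ⟨ε, hε, h1⟩ := pos (-P) fun t hct htd => by
      simpa using neg_of_sgn_eq (hsgn t hct htd) h0
    exact ⟨ε, hε, fun s hs t hct htd => by
      rw [sgn_neg h0, sgn_neg (by simpa using h1 s hs t hct htd)]⟩
  · obtain ⟨ε, hε, h1⟩ := pos P fun t hct htd => pos_of_sgn_eq (hsgn t hct htd) h0
    exact ⟨ε, hε, fun s hs t hct htd => by rw [sgn_pos h0, sgn_pos (h1 s hs t hct htd)]⟩

/-- Local homotopy invariance: the segment `{s₀} × [c,d]` is cut into pieces on each of which `P` or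
`Q` has no zero; this persists for `s` near `s₀`, so that the corresponding rectangles are mapped
into half planes. -/
theorem RealClosed.exists_boundaryIndex_eq_zero (hR : RealClosed R) {P Q : R[X][X]} {s₀ c d : R}
    (hcd : c < d) (h : NoCommonZero (row P s₀) (row Q s₀) c d) :
    ∃ ε > 0, ∀ s s', |s - s₀| < ε → |s' - s₀| < ε → s < s' → boundaryIndex P Q s s' c d = 0 := by
  classical
  have htrans : ∀ a b e, c ≤ a → a < b → b < e → e ≤ d →
      (∃ ε > 0, ∀ s s', |s - s₀| < ε → |s' - s₀| < ε → s < s' → boundaryIndex P Q s s' a b = 0) →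
      (∃ ε > 0, ∀ s s', |s - s₀| < ε → |s' - s₀| < ε → s < s' → boundaryIndex P Q s s' b e = 0) →
      ∃ ε > 0, ∀ s s', |s - s₀| < ε → |s' - s₀| < ε → s < s' → boundaryIndex P Q s s' a e = 0 := by
    rintro a b e - hab hbe - ⟨ε₁, hε₁, h₁⟩ ⟨ε₂, hε₂, h₂⟩
    refine ⟨min ε₁ ε₂, lt_min hε₁ hε₂, fun s s' hs hs' hss' => ?_⟩
    rw [lt_min_iff] at hs hs'
    rw [boundaryIndex_add_right _ _ _ _ hab hbe, h₁ s s' hs.1 hs'.1 hss', h₂ s s' hs.2 hs'.2 hss',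
      add_zero]
  have hmid : ∀ {s s' x : R} {ε : R}, |s - s₀| < ε → |s' - s₀| < ε → s ≤ x → x ≤ s' →
      |x - s₀| < ε := by
    intro s s' x ε h1 h2 h3 h4
    rw [abs_lt] at h1 h2 ⊢
    constructor <;> linarith
  have hpiece : ∀ a b, a < b →
      ((∀ t, a ≤ t → t ≤ b → P.evalEval s₀ t ≠ 0) ∨ (∀ t, a ≤ t → t ≤ b → Q.evalEval s₀ t ≠ 0)) →
      ∃ ε > 0, ∀ s s', |s - s₀| < ε → |s' - s₀| < ε → s < s' → boundaryIndex P Q s s' a b = 0 := by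
    rintro a b hab (hP | hQ)
    · obtain ⟨ε, hε, h1⟩ := hR.exists_sgn_evalEval_eq P hab hP
      exact ⟨ε, hε, fun s s' hs hs' hss' => hR.boundaryIndex_of_sgn_num hss' hab
        (sgn_ne_zero (hP a le_rfl hab.le))
        fun x y hx hx' hy hy' => h1 x (hmid hs hs' hx hx') y hy hy'⟩
    · obtain ⟨ε, hε, h1⟩ := hR.exists_sgn_evalEval_eq Q hab hQ
      exact ⟨ε, hε, fun s s' hs hs' hss' => hR.boundaryIndex_of_denom_ne_zero hss' hab
        fun x y hx hx' hy hy' => ne_zero_of_sgn_ne_zero (by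
          rw [h1 x (hmid hs hs' hx hx') y hy hy']; exact sgn_ne_zero (hQ a le_rfl hab.le))⟩
  refine simpleOn_induction {row P s₀, row Q s₀} (Φ := fun a b => ∃ ε > 0, ∀ s s', |s - s₀| < ε →
    |s' - s₀| < ε → s < s' → boundaryIndex P Q s s' a b = 0) htrans ?_ hcd
  intro a b hca hab hbd hS
  -- `P` and `Q` have no zeros in `]a,b[`; an end point can be a zero of one of them only
  have hP := hS (row P s₀) (by simp)
  have hQ := hS (row Q s₀) (by simp)
  rcases hP with hP | hP
  · refine hpiece a b hab (Or.inr fun t hat htb h0 => ?_)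
    refine h t (hca.trans hat) (htb.trans hbd) (by simpa using h0) (by simp [hP])
  rcases hQ with hQ | hQ
  · refine hpiece a b hab (Or.inl fun t hat htb h0 => ?_)
    refine h t (hca.trans hat) (htb.trans hbd) (by simp [hQ]) (by simpa using h0)
  simp only [eval_row] at hP hQ
  obtain ⟨m, ham, hmb⟩ := exists_between hab
  refine htrans a m b hca ham hmb hbd (hpiece a m ham ?_) (hpiece m b hmb ?_)
  · by_cases h0 : Q.evalEval s₀ a = 0
    · left
      intro t hat htm
      rcases hat.eq_or_lt with rfl | hat
      · simpa using h a hca (hab.le.trans hbd) (by simpa using h0)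
      · exact hP t hat (htm.trans_lt hmb)
    · right
      intro t hat htm
      rcases hat.eq_or_lt with rfl | hat
      · exact h0
      · exact hQ t hat (htm.trans_lt hmb)
  · by_cases h0 : Q.evalEval s₀ b = 0
    · left
      intro t hmt htb
      rcases htb.eq_or_lt with rfl | htb
      · simpa using h t (hca.trans hab.le) hbd (by simpa using h0)
      · exact hP t (ham.trans_le hmt) htb
    · right
      intro t hmt htb
      rcases htb.eq_or_lt with rfl | htb
      · exact h0
      · exact hQ t (ham.trans_le hmt) htb

theorem RealClosed.sgn_eval_eq_of_roots (hR : RealClosed R) {p : R[X]} {s s' : R} (hs : s ≤ s')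
    (h : ∀ x ∈ p.roots.toFinset, ¬ (s ≤ x ∧ x ≤ s')) : sgn (p.eval s) = sgn (p.eval s') := by
  by_cases hp : p = 0
  · simp [hp]
  · exact sgn_congr (hR.sign_eq_of_forall_ne hs fun x h1 h2 h3 => h x (by simp [hp, h3]) ⟨h1, h2⟩)

/-- The Cauchy index of `P(s, ·) / Q(s, ·)` is constant in `s` outside of finitely many exceptional
values. By pseudo-division and inversion it is expressed by signs of polynomials in `s` and by a
Cauchy index with a denominator of smaller degree. -/
theorem RealClosed.exists_cauchyIndex_row_eq (hR : RealClosed R) {c d : R} (hcd : c < d)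
    (P Q : R[X][X]) : ∃ E : Finset R, ∀ s s', s < s' → (∀ x ∈ E, ¬ (s ≤ x ∧ x ≤ s')) →
      (∀ x, s ≤ x → x ≤ s' → NoCommonZero (row P x) (row Q x) c d) →
      cauchyIndex (row P s) (row Q s) c d = cauchyIndex (row P s') (row Q s') c d := by
  classical
  induction hn : Q.degree using WellFoundedLT.induction generalizing P Q with
  | ind n ih =>
  subst hn
  by_cases hQ : Q = 0
  · exact ⟨∅, fun s s' _ _ _ => by simp [hQ, row, cauchyIndex]⟩
  obtain ⟨k, T, S, hdiv, hdeg⟩ := exists_pseudo_div P hQ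
  obtain ⟨E, hE⟩ := ih _ hdeg Q S rfl
  refine ⟨E ∪ Q.leadingCoeff.roots.toFinset ∪ (col Q c).roots.toFinset ∪ (col Q d).roots.toFinset ∪
    (col S c).roots.toFinset ∪ (col S d).roots.toFinset, fun s s' hs hfree hnz => ?_⟩
  simp only [Finset.mem_union, or_imp, forall_and] at hfree
  obtain ⟨⟨⟨⟨⟨hfE, hfl⟩, hfQc⟩, hfQd⟩, hfSc⟩, hfSd⟩ := hfree
  have hev : ∀ x t, Q.leadingCoeff.eval x ^ k * P.evalEval x t =
      T.evalEval x t * Q.evalEval x t + S.evalEval x t := fun x t => by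
    have := congrArg (evalEval x t) hdiv
    simpa [evalEval_add, evalEval_mul, evalEval_C] using this
  have hl : ∀ x, s ≤ x → x ≤ s' → Q.leadingCoeff.eval x ≠ 0 := fun x h1 h2 h3 =>
    hfl x (by simp [hQ, h3]) ⟨h1, h2⟩
  have hnz' : ∀ x, s ≤ x → x ≤ s' → NoCommonZero (row Q x) (row S x) c d := by
    intro x h1 h2 t h3 h4 h5 h6
    rw [eval_row] at h5 h6
    have := hev x t
    rw [h5, h6, mul_zero, add_zero] at this
    exact hnz x h1 h2 t h3 h4 (by simpa using h6)
      (by simpa using (mul_eq_zero.1 this).resolve_left (pow_ne_zero k (hl x h1 h2)))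
  have hS : ∀ x, s ≤ x → x ≤ s' → cauchyIndex (row S x) (row Q x) c d =
      sgn (Q.leadingCoeff.eval x ^ k) * cauchyIndex (row P x) (row Q x) c d := fun x h1 h2 =>
    hR.cauchyIndex_eq_mul hcd (hnz x h1 h2) (sgn_ne_zero (pow_ne_zero k (hl x h1 h2)))
      fun t h3 h4 h5 => by
        have := hev x t
        rw [eval_row] at h5
        rw [h5, mul_zero, zero_add] at this
        rw [eval_row, eval_row, ← this, sgn_mul]
  have hinv : ∀ x, s ≤ x → x ≤ s' →
      sgn (Q.leadingCoeff.eval x ^ k) * cauchyIndex (row P x) (row Q x) c d =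
        signVar (Q.evalEval x c) (S.evalEval x c) - signVar (Q.evalEval x d) (S.evalEval x d)
          - cauchyIndex (row Q x) (row S x) c d := fun x h1 h2 => by
    have := hR.cauchyIndex_add_swap hcd (hnz' x h1 h2)
    rw [hS x h1 h2] at this
    simp only [eval_row] at this
    rw [← this]; ring
  have e1 := hinv s le_rfl hs.le
  have e2 := hinv s' hs.le le_rfl
  have hQc := hR.sgn_eval_eq_of_roots hs.le hfQc
  have hQd := hR.sgn_eval_eq_of_roots hs.le hfQd
  have hSc := hR.sgn_eval_eq_of_roots hs.le hfSc
  have hSd := hR.sgn_eval_eq_of_roots hs.le hfSd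
  have hlc : sgn (Q.leadingCoeff.eval s ^ k) = sgn (Q.leadingCoeff.eval s' ^ k) := by
    rw [← eval_pow, ← eval_pow]
    refine sgn_congr (hR.sign_eq_of_forall_ne hs.le fun x h1 h2 => ?_)
    rw [eval_pow]
    exact pow_ne_zero k (hl x h1 h2)
  simp only [eval_col] at hQc hQd hSc hSd
  rw [signVar, signVar, hQc, hQd, hSc, hSd, hE s s' hs hfE hnz', ← signVar, ← signVar, ← e2, hlc]
    at e1
  exact mul_left_cancel₀ (sgn_ne_zero (pow_ne_zero k (hl s' hs.le le_rfl))) e1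

/-- A polynomial map without zeros on a rectangle has index `0` along its boundary. -/
theorem RealClosed.boundaryIndex_eq_zero (hR : RealClosed R) {P Q : R[X][X]} {a b c d : R}
    (hab : a < b) (hcd : c < d)
    (h : ∀ x, a ≤ x → x ≤ b → NoCommonZero (row P x) (row Q x) c d) :
    boundaryIndex P Q a b c d = 0 := by
  classical
  obtain ⟨E, hE⟩ := hR.exists_cauchyIndex_row_eq hcd P Q
  refine interval_induction (E ∪ (col Q c).roots.toFinset ∪ (col Q d).roots.toFinset)
    (Φ := fun a b => boundaryIndex P Q a b c d = 0) ?_ ?_ hab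
  · intro x y z _ hxy hyz _ h1 h2
    rw [boundaryIndex_add_left _ _ _ _ hxy hyz, h1, h2, add_zero]
  · intro x y hax hxy hyb hfree
    -- split off short intervals at both end points, which may be exceptional values
    obtain ⟨ε₁, hε₁, h₁⟩ := hR.exists_boundaryIndex_eq_zero hcd (h x hax (hxy.le.trans hyb))
    obtain ⟨ε₂, hε₂, h₂⟩ := hR.exists_boundaryIndex_eq_zero hcd (h y (hax.trans hxy.le) hyb)
    obtain ⟨u, hxu, hu⟩ := exists_between (lt_min (lt_add_of_pos_right x hε₁) hxy)
    obtain ⟨hu1, huy⟩ := lt_min_iff.1 hu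
    obtain ⟨v, hv, hvy⟩ := exists_between (max_lt (sub_lt_self y hε₂) huy)
    obtain ⟨hv1, huv⟩ := max_lt_iff.1 hv
    have hfree' : ∀ w ∈ E ∪ (col Q c).roots.toFinset ∪ (col Q d).roots.toFinset,
        ¬ (u ≤ w ∧ w ≤ v) := fun w hw h' => hfree w hw ⟨hxu.trans_le h'.1, h'.2.trans_lt hvy⟩
    simp only [Finset.mem_union, or_imp, forall_and] at hfree'
    obtain ⟨⟨hfE, hfc⟩, hfd⟩ := hfree'
    have hcol : ∀ t, (∀ w ∈ (col Q t).roots.toFinset, ¬ (u ≤ w ∧ w ≤ v)) →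
        cauchyIndex (col P t) (col Q t) u v = 0 := by
      intro t ht
      by_cases hQ : col Q t = 0
      · simp [cauchyIndex, hQ]
      · exact hR.cauchyIndex_of_denom_ne_zero huv
          fun w h1 h2 h3 => ht w (by rw [Multiset.mem_toFinset, mem_roots hQ]; exact h3) ⟨h1, h2⟩
    have hmid : boundaryIndex P Q u v c d = 0 := by
      rw [boundaryIndex, hcol c hfc, hcol d hfd, hE u v huv hfE fun w h1 h2 =>
        h w (hax.trans (hxu.le.trans h1)) ((h2.trans hvy.le).trans hyb)]
      ring
    rw [boundaryIndex_add_left _ _ _ _ hxu huy, boundaryIndex_add_left _ _ _ _ huv hvy, hmid,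
      h₁ x u (by simpa using hε₁) (by rw [abs_of_pos (sub_pos.2 hxu)]; linarith) hxu,
      h₂ v y (by rw [abs_of_neg (sub_neg.2 hvy)]; linarith) (by simpa using hε₂) hvy]
    norm_num

end AlgIndex

namespace AlgIndex

/-! ### Real and imaginary parts of polynomials over `R[i]` -/

section ReIm

variable {R : Type*} [Field R]

theorem re_mul_algebraMap (z : Cx R) (r : R) : (z * algebraMap R (Cx R) r).re = z.re * r := by
  simp

theorem im_mul_algebraMap (z : Cx R) (r : R) : (z * algebraMap R (Cx R) r).im = z.im * r := by
  simp

theorem eval_rePoly (G : (Cx R)[X]) (x : R) :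
    (rePoly G).eval x = (G.eval (algebraMap R (Cx R) x)).re := by
  have h : ∀ z : Cx R, z.re = QuadraticAlgebra.reₗ (-1) 0 z := fun _ => rfl
  rw [rePoly, eval_eq_sum (p := G), Polynomial.sum, Polynomial.sum, eval_finsetSum, h, map_sum]
  refine Finset.sum_congr rfl fun n _ => ?_
  rw [← h, eval_monomial, ← map_pow, re_mul_algebraMap]

theorem eval_imPoly (G : (Cx R)[X]) (x : R) :
    (imPoly G).eval x = (G.eval (algebraMap R (Cx R) x)).im := by
  have h : ∀ z : Cx R, z.im = QuadraticAlgebra.imₗ (-1) 0 z := fun _ => rfl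
  rw [imPoly, eval_eq_sum (p := G), Polynomial.sum, Polynomial.sum, eval_finsetSum, h, map_sum]
  refine Finset.sum_congr rfl fun n _ => ?_
  rw [← h, eval_monomial, ← map_pow, im_mul_algebraMap]

theorem eval_segPoly (G : (Cx R)[X]) (a b x : R) :
    (segPoly G a b).eval (algebraMap R (Cx R) x) =
      G.eval (algebraMap R (Cx R) ((b - a) * x + a)) := by
  simp [segPoly, eval_comp]

theorem exists_re_im_evalEval (F : (Cx R)[X][X]) : ∃ P Q : R[X][X], ∀ x y,
    F.evalEval (algebraMap R (Cx R) x) (algebraMap R (Cx R) y) =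
      ⟨P.evalEval x y, Q.evalEval x y⟩ := by
  induction F using Polynomial.induction_on' with
  | add F G hF hG =>
    obtain ⟨P, Q, h⟩ := hF
    obtain ⟨P', Q', h'⟩ := hG
    exact ⟨P + P', Q + Q', fun x y => by
      rw [evalEval_add, h, h', evalEval_add, evalEval_add]; rfl⟩
  | monomial n c =>
    refine ⟨monomial n (rePoly c), monomial n (imPoly c), fun x y => ?_⟩
    simp only [evalEval, eval_monomial, eval_mul, eval_C, ← map_pow]
    ext
    · rw [re_mul_algebraMap, eval_rePoly]
    · rw [im_mul_algebraMap, eval_imPoly]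

theorem cx_ne_zero_iff {z : Cx R} : z ≠ 0 ↔ (z.im = 0 → z.re ≠ 0) := by
  rw [Ne, QuadraticAlgebra.ext_iff]
  simp only [QuadraticAlgebra.re_zero, QuadraticAlgebra.im_zero]
  tauto

end ReIm

/-! ### Piecewise polynomial paths -/

section Paths

variable {R : Type*} [Field R] [LinearOrder R]

/-- The function real part over imaginary part of a path, whose index on an interval is twice the
index of the path. -/
def ratio (γ : R → Cx R) : R → R := fun x => (γ x).re / (γ x).im

/-- The path `γ` is piecewise polynomial on `[a,b]`: polynomial on all intervals whose interior
avoids a finite set of break points. -/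
def PiecewisePolyOn (γ : R → Cx R) (a b : R) : Prop :=
  ∃ E : Finset R, ∀ c d, a ≤ c → c < d → d ≤ b → (∀ x ∈ E, ¬ (c < x ∧ x < d)) →
    ∃ G : (Cx R)[X], ∀ x, c ≤ x → x ≤ d → γ x = G.eval (algebraMap R (Cx R) x)

theorem PiecewisePolyOn.mono {γ : R → Cx R} {a b c d : R} (h : PiecewisePolyOn γ a b) (hac : a ≤ c)
    (hdb : d ≤ b) : PiecewisePolyOn γ c d :=
  h.imp fun _ hE u v h1 h2 h3 => hE u v (hac.trans h1) h2 (h3.trans hdb)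

theorem PiecewisePolyOn.mul {γ₁ γ₂ : R → Cx R} {a b : R} (h₁ : PiecewisePolyOn γ₁ a b)
    (h₂ : PiecewisePolyOn γ₂ a b) : PiecewisePolyOn (γ₁ * γ₂) a b := by
  classical
  obtain ⟨E₁, h₁⟩ := h₁
  obtain ⟨E₂, h₂⟩ := h₂
  refine ⟨E₁ ∪ E₂, fun c d hac hcd hdb hE => ?_⟩
  obtain ⟨G₁, hG₁⟩ := h₁ c d hac hcd hdb fun x hx => hE x (Finset.mem_union_left _ hx)
  obtain ⟨G₂, hG₂⟩ := h₂ c d hac hcd hdb fun x hx => hE x (Finset.mem_union_right _ hx)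
  exact ⟨G₁ * G₂, fun x h1 h2 => by rw [Pi.mul_apply, hG₁ x h1 h2, hG₂ x h1 h2, eval_mul]⟩

variable [IsStrictOrderedRing R]

omit [IsStrictOrderedRing R] in
theorem PiecewisePolyOn.induction {γ : R → Cx R} {Φ : R → R → Prop} {a b : R}
    (h : PiecewisePolyOn γ a b)
    (htrans : ∀ c d e, a ≤ c → c < d → d < e → e ≤ b → Φ c d → Φ d e → Φ c e)
    (hpoly : ∀ c d, a ≤ c → c < d → d ≤ b → ∀ P Q : R[X],
      (∀ x, c ≤ x → x ≤ d → γ x = ⟨P.eval x, Q.eval x⟩) → Φ c d)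
    (hab : a < b) : Φ a b := by
  obtain ⟨E, hE⟩ := h
  refine interval_induction E htrans (fun c d hac hcd hdb hfree => ?_) hab
  obtain ⟨G, hG⟩ := hE c d hac hcd hdb hfree
  refine hpoly c d hac hcd hdb (rePoly G) (imPoly G) fun x h1 h2 => ?_
  rw [hG x h1 h2, eval_rePoly, eval_imPoly]

theorem hasIndex_ratio {γ : R → Cx R} {P Q : R[X]} {a b : R} (hab : a < b)
    (h : ∀ x, a ≤ x → x ≤ b → γ x = ⟨P.eval x, Q.eval x⟩) :
    HasIndex (ratio γ) a b (cauchyIndex P Q a b) :=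
  (hasIndex_cauchyIndex P Q hab).congr hab fun x h1 h2 => by
    rw [ratio, h x h1.le h2.le, fracFun]

omit [IsStrictOrderedRing R] in
theorem noCommonZero_of_path {γ : R → Cx R} {P Q : R[X]} {a b : R}
    (h : ∀ x, a ≤ x → x ≤ b → γ x = ⟨P.eval x, Q.eval x⟩) (h0 : ∀ x, a ≤ x → x ≤ b → γ x ≠ 0) :
    NoCommonZero P Q a b := fun x h1 h2 => by
  have := cx_ne_zero_iff.1 (h0 x h1 h2)
  rwa [h x h1 h2] at this

/-- Modulo full turns, the index of a path is the difference of the coarse angles at its ends. -/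
theorem RealClosed.hasIndex_turn (hR : RealClosed R) {γ : R → Cx R} {a b : R} (hab : a < b)
    (hγ : PiecewisePolyOn γ a b) (h0 : ∀ x, a ≤ x → x ≤ b → γ x ≠ 0) :
    ∃ m : ℤ, HasIndex (ratio γ) a b
      (2 * (turn (γ b).re (γ b).im - turn (γ a).re (γ a).im + m)) := by
  refine hγ.induction (Φ := fun a b => ∃ m : ℤ, HasIndex (ratio γ) a b
      (2 * (turn (γ b).re (γ b).im - turn (γ a).re (γ a).im + m))) ?_ ?_ hab
  · rintro c d e - hcd hde - ⟨m, hm⟩ ⟨n, hn⟩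
    refine ⟨m + n, ?_⟩
    convert hm.trans hn hcd hde using 1
    push_cast
    ring
  · intro c d hac hcd hdb P Q h
    obtain ⟨m, hm⟩ := hR.cauchyIndex_turn hcd (noCommonZero_of_path h
      fun x h1 h2 => h0 x (hac.trans h1) (h2.trans hdb))
    refine ⟨m, ?_⟩
    rw [h c le_rfl hcd.le, h d hcd.le le_rfl, ← hm]
    convert hasIndex_ratio hcd h using 1
    ring

/-- The product formula for piecewise polynomial paths. -/
theorem RealClosed.hasIndex_mul (hR : RealClosed R) {γ₁ γ₂ : R → Cx R} {a b : R} (hab : a < b)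
    (hγ₁ : PiecewisePolyOn γ₁ a b) (h₁ : ∀ x, a ≤ x → x ≤ b → γ₁ x ≠ 0)
    (hγ₂ : PiecewisePolyOn γ₂ a b) (h₂ : ∀ x, a ≤ x → x ≤ b → γ₂ x ≠ 0) :
    ∃ q₁ q₂, HasIndex (ratio γ₁) a b q₁ ∧ HasIndex (ratio γ₂) a b q₂ ∧
      HasIndex (ratio (γ₁ * γ₂)) a b (q₁ + q₂
        + 1 / 2 * (prodTerm (γ₁ a).re (γ₁ a).im (γ₂ a).re (γ₂ a).im
          - prodTerm (γ₁ b).re (γ₁ b).im (γ₂ b).re (γ₂ b).im)) := by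
  have htrans : ∀ c d e, a ≤ c → c < d → d < e → e ≤ b →
      (∃ q₁ q₂, HasIndex (ratio γ₁) c d q₁ ∧ HasIndex (ratio γ₂) c d q₂ ∧
        HasIndex (ratio (γ₁ * γ₂)) c d (q₁ + q₂
          + 1 / 2 * (prodTerm (γ₁ c).re (γ₁ c).im (γ₂ c).re (γ₂ c).im
            - prodTerm (γ₁ d).re (γ₁ d).im (γ₂ d).re (γ₂ d).im))) →
      (∃ q₁ q₂, HasIndex (ratio γ₁) d e q₁ ∧ HasIndex (ratio γ₂) d e q₂ ∧
        HasIndex (ratio (γ₁ * γ₂)) d e (q₁ + q₂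
          + 1 / 2 * (prodTerm (γ₁ d).re (γ₁ d).im (γ₂ d).re (γ₂ d).im
            - prodTerm (γ₁ e).re (γ₁ e).im (γ₂ e).re (γ₂ e).im))) →
      ∃ q₁ q₂, HasIndex (ratio γ₁) c e q₁ ∧ HasIndex (ratio γ₂) c e q₂ ∧
        HasIndex (ratio (γ₁ * γ₂)) c e (q₁ + q₂
          + 1 / 2 * (prodTerm (γ₁ c).re (γ₁ c).im (γ₂ c).re (γ₂ c).im
            - prodTerm (γ₁ e).re (γ₁ e).im (γ₂ e).re (γ₂ e).im)) := by
    rintro c d e - hcd hde - ⟨q₁, q₂, k₁, k₂, k₃⟩ ⟨r₁, r₂, l₁, l₂, l₃⟩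
    refine ⟨_, _, k₁.trans l₁ hcd hde, k₂.trans l₂ hcd hde, ?_⟩
    convert k₃.trans l₃ hcd hde using 1
    ring
  refine hγ₁.induction htrans (fun c d hac hcd hdb P₁ Q₁ e₁ => ?_) hab
  refine (hγ₂.mono hac hdb).induction
    (fun u v w h1 h2 h3 h4 => htrans u v w (hac.trans h1) h2 h3 (h4.trans hdb))
    (fun u v hcu huv hvd P₂ Q₂ e₂ => ?_) hcd
  replace e₁ : ∀ x, u ≤ x → x ≤ v → γ₁ x = ⟨P₁.eval x, Q₁.eval x⟩ :=
    fun x h1 h2 => e₁ x (hcu.trans h1) (h2.trans hvd)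
  have hau := hac.trans hcu
  have hvb := hvd.trans hdb
  have hP := hR.cauchyIndex_product huv
    (noCommonZero_of_path e₁ fun x k1 k2 => h₁ x (hau.trans k1) (k2.trans hvb))
    (noCommonZero_of_path e₂ fun x k1 k2 => h₂ x (hau.trans k1) (k2.trans hvb))
  refine ⟨_, _, hasIndex_ratio huv e₁, hasIndex_ratio huv e₂, ?_⟩
  rw [e₁ u le_rfl huv.le, e₁ v huv.le le_rfl, e₂ u le_rfl huv.le, e₂ v huv.le le_rfl, ← hP]
  refine hasIndex_ratio huv fun x k1 k2 => ?_
  rw [Pi.mul_apply, e₁ x k1 k2, e₂ x k1 k2]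
  ext
  · simp [sub_eq_add_neg]
  · simp

/-- Twice the index of a path in a vertical line. On the imaginary axis, that is for `c = 0`, the
ratio is `0`, and so is the index. -/
theorem RealClosed.hasIndex_of_re_eq (hR : RealClosed R) {γ : R → Cx R} {a b c : R} (hab : a < b)
    (hγ : PiecewisePolyOn γ a b) (hc : ∀ x, a ≤ x → x ≤ b → (γ x).re = c) :
    HasIndex (ratio γ) a b (sgn c * (sgn (γ b).im - sgn (γ a).im) / 2) := by
  by_cases hc0 : c = 0
  · subst hc0
    have := (hasIndex_zero a b).congr (g := ratio γ) hab fun x h1 h2 => by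
      rw [ratio, hc x h1.le h2.le, zero_div]
    simpa using this
  refine hγ.induction (Φ := fun a b => HasIndex (ratio γ) a b
    (sgn c * (sgn (γ b).im - sgn (γ a).im) / 2)) ?_ ?_ hab
  · intro u v w _ huv hvw _ h1 h2
    convert h1.trans h2 huv hvw using 1
    ring
  · intro u v hau huv hvb P Q h
    have hP : ∀ x, u ≤ x → x ≤ v → P.eval x = c := fun x h1 h2 => by
      rw [← hc x (hau.trans h1) (h2.trans hvb), h x h1 h2]
    have := hasIndex_ratio huv h
    rw [hR.cauchyIndex_of_num_ne_zero huv fun x h1 h2 => by rwa [hP x h1 h2],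
      hP u le_rfl huv.le] at this
    rwa [h u le_rfl huv.le, h v huv.le le_rfl]

/-- The index of a path in a horizontal line vanishes. On the real axis, that is for `c = 0`, this
holds because `ratio` takes the junk value `0` of a division by `0`, in accordance with the
convention `Ind(P/0) = 0`. -/
theorem RealClosed.hasIndex_of_im_eq (hR : RealClosed R) {γ : R → Cx R} {a b c : R} (hab : a < b)
    (hγ : PiecewisePolyOn γ a b) (hc : ∀ x, a ≤ x → x ≤ b → (γ x).im = c) :
    HasIndex (ratio γ) a b 0 := by
  by_cases hc0 : c = 0
  · subst hc0
    exact (hasIndex_zero a b).congr (g := ratio γ) hab fun x h1 h2 => by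
      rw [ratio, hc x h1.le h2.le, div_zero]
  refine hγ.induction (Φ := fun a b => HasIndex (ratio γ) a b 0) ?_ ?_ hab
  · intro u v w _ huv hvw _ h1 h2
    simpa using h1.trans h2 huv hvw
  · intro u v hau huv hvb P Q h
    have hQ : ∀ x, u ≤ x → x ≤ v → Q.eval x ≠ 0 := fun x h1 h2 => by
      have := hc x (hau.trans h1) (h2.trans hvb)
      rw [h x h1 h2] at this
      rwa [show Q.eval x = c from this]
    have := hasIndex_ratio huv h
    rwa [hR.cauchyIndex_of_denom_ne_zero huv hQ] at this

/-! ### Presentations by subdivisions -/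

omit [Field R] [IsStrictOrderedRing R] in
/-- An interval whose interior avoids the points of a subdivision lies in one of the pieces. -/
theorem exists_subdivision_piece {n : ℕ} {t : Fin (n + 1) → R} {c d : R} (h0 : t 0 ≤ c)
    (h1 : c < t (Fin.last n)) (hfree : ∀ k, ¬ (c < t k ∧ t k < d)) :
    ∃ k : Fin n, t k.castSucc ≤ c ∧ d ≤ t k.succ := by
  by_contra! hcon
  have : ∀ k, t k ≤ c := fun k => by
    induction k using Fin.induction with
    | zero => exact h0
    | succ k ih => exact not_lt.1 fun h => hfree k.succ ⟨h, hcon k ih⟩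
  exact (this _).not_gt h1

omit [Field R] [IsStrictOrderedRing R] in
theorem hasIndex_sum {f : R → R} {n : ℕ} {t : Fin (n + 1) → R} (ht : StrictMono t) (hn : n ≠ 0)
    {q : Fin n → ℚ} (h : ∀ k : Fin n, HasIndex f (t k.castSucc) (t k.succ) (q k)) :
    HasIndex f (t 0) (t (Fin.last n)) (∑ k, q k) := by
  induction n with
  | zero => exact absurd rfl hn
  | succ n ih =>
    rw [Fin.sum_univ_castSucc]
    by_cases hn0 : n = 0
    · subst hn0
      simpa using h 0
    · have := ih (t := fun k => t k.castSucc) (ht.comp (Fin.strictMono_castSucc)) hn0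
        (q := fun k => q k.castSucc) fun k => h k.castSucc
      refine this.trans (h (Fin.last n)) (ht ?_) (ht ?_)
      · rw [Fin.castSucc_zero, ← Fin.castSucc_zero, Fin.castSucc_lt_castSucc_iff]
        exact Fin.pos_iff_ne_zero.2 (by simpa [Fin.ext_iff] using hn0)
      · exact Fin.castSucc_lt_succ

/-- The extension of a path on the unit interval to `R`, constant outside of `[0,1]`. -/
def extend {α : Type*} (γ : UI R → α) : R → α := Set.IccExtend zero_le_one γ

theorem extend_of_mem {α : Type*} (γ : UI R → α) {x : R} (h0 : 0 ≤ x) (h1 : x ≤ 1) :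
    extend γ x = γ ⟨x, h0, h1⟩ := Set.IccExtend_of_mem _ _ ⟨h0, h1⟩

omit [IsStrictOrderedRing R] in
theorem IsSubdivision.mem {n : ℕ} {t : Fin (n + 1) → R} (h : IsSubdivision t) (k : Fin (n + 1)) :
    0 ≤ t k ∧ t k ≤ 1 :=
  ⟨h.2.1 ▸ h.1.monotone (Fin.zero_le k), h.2.2 ▸ h.1.monotone (Fin.le_last k)⟩

theorem IsSubdivision.ne_zero {n : ℕ} {t : Fin (n + 1) → R} (h : IsSubdivision t) : n ≠ 0 := by
  rintro rfl
  exact zero_ne_one (h.2.1.symm.trans h.2.2)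

theorem IsPresentation.eq_eval {γ : UI R → Cx R} {n : ℕ} {t : Fin (n + 1) → R}
    {G : Fin n → (Cx R)[X]} (h : IsPresentation γ t G) (k : Fin n) {x : R}
    (h1 : t k.castSucc ≤ x) (h2 : x ≤ t k.succ) :
    extend γ x = (G k).eval (algebraMap R (Cx R) x) := by
  have h3 := (h.1.mem k.castSucc).1.trans h1
  have h4 := h2.trans (h.1.mem k.succ).2
  rw [extend_of_mem γ h3 h4]
  exact h.2 k ⟨x, h3, h4⟩ h1 h2

theorem IsPiecewisePoly.piecewisePolyOn {γ : UI R → Cx R} (h : IsPiecewisePoly γ) :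
    PiecewisePolyOn (extend γ) 0 1 := by
  classical
  obtain ⟨n, t, G, h⟩ := h
  refine ⟨Finset.univ.image t, fun c d hc hcd hd hfree => ?_⟩
  obtain ⟨k, h1, h2⟩ := exists_subdivision_piece (t := t) (c := c) (d := d) (by rwa [h.1.2.1])
    (by rw [h.1.2.2]; exact hcd.trans_le hd) fun k => hfree _ (by simp)
  exact ⟨G k, fun x h3 h4 => h.eq_eval k (h1.trans h3) (h4.trans h2)⟩

theorem PiecewisePolyOn.isPiecewisePoly {γ : UI R → Cx R} (h : PiecewisePolyOn (extend γ) 0 1) :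
    IsPiecewisePoly γ := by
  classical
  obtain ⟨E, hE⟩ := h
  -- the break points in `]0,1[` together with `0` and `1`, in increasing order, form a subdivision
  set F : Finset R := insert 0 (insert 1 (E.filter fun x => 0 < x ∧ x < 1)) with hF
  have hF0 : ∀ x ∈ F, 0 ≤ x ∧ x ≤ 1 := by
    intro x hx
    simp only [hF, Finset.mem_insert, Finset.mem_filter] at hx
    rcases hx with rfl | rfl | h
    · simp
    · simp
    · exact ⟨h.2.1.le, h.2.2.le⟩
  have hcard : 2 ≤ F.card := by
    rw [hF, Finset.card_insert_of_notMem (by simp), Finset.card_insert_of_notMem (by simp)]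
    omega
  obtain ⟨n, hn⟩ : ∃ n, F.card = n + 1 := ⟨F.card - 1, by omega⟩
  set t := F.orderEmbOfFin hn
  have ht : ∀ k, t k ∈ F := fun k => Finset.orderEmbOfFin_mem F hn k
  have hsurj : ∀ x ∈ F, ∃ k, t k = x := fun x hx => by
    have : x ∈ Set.range t := by rw [Finset.range_orderEmbOfFin]; exact hx
    exact this
  have hsub : IsSubdivision t := by
    refine ⟨t.strictMono, le_antisymm ?_ (hF0 _ (ht 0)).1, le_antisymm (hF0 _ (ht _)).2 ?_⟩
    · obtain ⟨k, hk⟩ := hsurj 0 (by simp [hF])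
      rw [← hk]; exact t.monotone (Fin.zero_le k)
    · obtain ⟨k, hk⟩ := hsurj 1 (by simp [hF])
      rw [← hk]; exact t.monotone (Fin.le_last k)
  have hG : ∀ k : Fin n, ∃ G : (Cx R)[X], ∀ x, t k.castSucc ≤ x → x ≤ t k.succ →
      extend γ x = G.eval (algebraMap R (Cx R) x) := by
    intro k
    have h0 := (hsub.mem k.castSucc).1
    have h1 := (hsub.mem k.succ).2
    refine hE _ _ h0 (t.strictMono Fin.castSucc_lt_succ) h1 fun x hx hx' => ?_
    obtain ⟨j, rfl⟩ := hsurj x (by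
      simp only [hF, Finset.mem_insert, Finset.mem_filter]
      exact Or.inr (Or.inr ⟨hx, h0.trans_lt hx'.1, hx'.2.trans_le h1⟩))
    have h2 := t.lt_iff_lt.1 hx'.1
    have h3 := t.lt_iff_lt.1 hx'.2
    rw [Fin.lt_def] at h2 h3
    simp at h2 h3
    omega
  choose G hG using hG
  refine ⟨n, t, G, hsub, fun k x h1 h2 => ?_⟩
  rw [← hG k x h1 h2, extend_of_mem γ x.2.1 x.2.2]

omit [LinearOrder R] [IsStrictOrderedRing R] in
theorem fracFun_segPoly (G : (Cx R)[X]) (a b : R) :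
    fracFun (rePoly (segPoly G a b)) (imPoly (segPoly G a b)) =
      fun x => fracFun (rePoly G) (imPoly G) ((b - a) * x + a) := by
  ext x
  simp only [fracFun, eval_rePoly, eval_imPoly, eval_segPoly]

theorem segIndex_eq (G : (Cx R)[X]) {a b : R} (hab : a < b) :
    segIndex G a b = 1 / 2 * cauchyIndex (rePoly G) (imPoly G) a b := by
  rw [segIndex]
  congr 1
  refine (hasIndex_cauchyIndex _ _ zero_lt_one).unique ?_
  rw [fracFun_segPoly]
  exact (hasIndex_cauchyIndex (rePoly G) (imPoly G) hab).comp_affine hab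

theorem RealClosed.segSturm_eq (hR : RealClosed R) {G : (Cx R)[X]} {a b : R} (hab : a < b)
    (h : ∀ x, a ≤ x → x ≤ b → G.eval (algebraMap R (Cx R) x) ≠ 0) :
    segSturm G a b = segIndex G a b := by
  rw [segSturm, segIndex, hR.cauchyIndex_eq_sturmIndex zero_lt_one]
  intro x h0 h1
  rw [eval_rePoly, eval_imPoly, eval_segPoly]
  have hm := sub_nonneg.2 hab.le
  refine cx_ne_zero_iff.1 (h _ ?_ ?_)
  · have := mul_nonneg hm h0; linarith
  · have := mul_le_mul_of_nonneg_left h1 hm; linarith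

theorem IsPresentation.hasIndex {γ : UI R → Cx R} {n : ℕ} {t : Fin (n + 1) → R}
    {G : Fin n → (Cx R)[X]} (h : IsPresentation γ t G) :
    HasIndex (ratio (extend γ)) 0 1
      (2 * ∑ k : Fin n, segIndex (G k) (t k.castSucc) (t k.succ)) := by
  have := hasIndex_sum (f := ratio (extend γ)) h.1.1 h.1.ne_zero
    (q := fun k => cauchyIndex (rePoly (G k)) (imPoly (G k)) (t k.castSucc) (t k.succ))
    fun k => hasIndex_ratio (h.1.1 Fin.castSucc_lt_succ) fun x h1 h2 => by
      rw [h.eq_eval k h1 h2, eval_rePoly, eval_imPoly]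
  rw [h.1.2.1, h.1.2.2] at this
  convert this using 1
  rw [Finset.mul_sum]
  refine Finset.sum_congr rfl fun k _ => ?_
  rw [segIndex_eq _ (h.1.1 Fin.castSucc_lt_succ)]
  ring

end Paths

end AlgIndex

namespace AlgIndex

variable {R : Type*} [Field R] [LinearOrder R] [IsStrictOrderedRing R]

/-! ### The boundary of a rectangle -/

/-- The path `γ` has twice the index `q` on `[a,b]`, where the case `a = b` is allowed. -/
def PathHasIndex (γ : R → Cx R) (a b : R) (q : ℚ) : Prop :=
  a = b ∧ q = 0 ∨ a < b ∧ HasIndex (ratio γ) a b q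

omit [IsStrictOrderedRing R] in
theorem PathHasIndex.trans {γ : R → Cx R} {a b c : R} {q r : ℚ} (h₁ : PathHasIndex γ a b q)
    (h₂ : PathHasIndex γ b c r) : PathHasIndex γ a c (q + r) := by
  rcases h₁ with ⟨rfl, rfl⟩ | ⟨hab, h₁⟩
  · simpa using h₂
  rcases h₂ with ⟨rfl, rfl⟩ | ⟨hbc, h₂⟩
  · exact Or.inr ⟨hab, by simpa using h₁⟩
  · exact Or.inr ⟨hab.trans hbc, h₁.trans h₂ hab hbc⟩

/-- Twice the index of a path along a horizontal or vertical segment from `u` to `v`, running from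
the parameter `l` to the parameter `r`. It vanishes for horizontal segments. -/
def edgeIndex (u v : Cx R) (l r : R) : ℚ :=
  sgn u.re * (sgn (u.im + r * (v.im - u.im)) - sgn (u.im + l * (v.im - u.im))) / 2

theorem RealClosed.pathHasIndex_edge (hR : RealClosed R) {γ : UI R → Cx R}
    (hγ : PiecewisePolyOn (extend γ) 0 1) {p q : UI R} (hpq : p ≤ q) {u v : Cx R} {l r : R}
    (huv : u.re = v.re ∨ u.im = v.im) (h : RunsAlong γ p q u v l r) :
    PathHasIndex (extend γ) p q (edgeIndex u v l r) := by
  obtain ⟨φ, -, hp, hq, hφ⟩ := h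
  rcases hpq.eq_or_lt with rfl | hlt
  · exact Or.inl ⟨rfl, by simp [edgeIndex, ← hp, ← hq]⟩
  have hlt' : (p : R) < q := hlt
  refine Or.inr ⟨hlt', ?_⟩
  have hmono := hγ.mono p.2.1 q.2.2
  have hx : ∀ x : R, (hpx : (p : R) ≤ x) → (hxq : x ≤ q) →
      extend γ x = u + φ ⟨x, p.2.1.trans hpx, hxq.trans q.2.2⟩ • (v - u) := fun x hpx hxq => by
    rw [extend_of_mem γ (p.2.1.trans hpx) (hxq.trans q.2.2)]
    exact hφ _ ⟨hpx, hxq⟩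
  rcases huv with huv | huv
  · have := hR.hasIndex_of_re_eq (c := u.re) hlt' hmono fun x h1 h2 => by
      rw [hx x h1 h2]; simp [huv]
    rw [hx _ le_rfl hlt'.le, hx _ hlt'.le le_rfl] at this
    simpa [edgeIndex, hp, hq] using this
  · have := hR.hasIndex_of_im_eq (c := u.im) hlt' hmono fun x h1 h2 => by
      rw [hx x h1 h2]; simp [huv]
    simpa [edgeIndex, huv] using this

/-- Twice the index of the boundary of a rectangle. Only the two vertical sides contribute; the
starting point, which cuts one side into two pieces, does not matter. -/
theorem RealClosed.hasIndex_rectangle (hR : RealClosed R) {γ : UI R → Cx R}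
    (hγ : PiecewisePolyOn (extend γ) 0 1) {x₀ x₁ y₀ y₁ : R}
    (h : ParametrizesBoundary γ x₀ x₁ y₀ y₁) :
    HasIndex (ratio (extend γ)) 0 1 ((sgn x₁ - sgn x₀) * (sgn y₁ - sgn y₀) / 2) := by
  obtain ⟨j, l, p₁, p₂, p₃, p₄, -, -, h12, h23, h34, r₁, r₂, r₃, r₄, r₅⟩ := h
  have hc : ∀ j, (corner x₀ x₁ y₀ y₁ j).re = (corner x₀ x₁ y₀ y₁ (j + 1)).re ∨
      (corner x₀ x₁ y₀ y₁ j).im = (corner x₀ x₁ y₀ y₁ (j + 1)).im := by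
    intro j; fin_cases j <;> simp [corner]
  have hc₂ := hc (j + 1)
  have hc₃ := hc (j + 2)
  have hc₄ := hc (j + 3)
  rw [show j + 1 + 1 = j + 2 by fin_cases j <;> rfl] at hc₂
  rw [show j + 2 + 1 = j + 3 by fin_cases j <;> rfl] at hc₃
  rw [show j + 3 + 1 = j by fin_cases j <;> rfl] at hc₄
  have key := ((((hR.pathHasIndex_edge hγ p₁.2.1 (hc j) r₁).trans
    (hR.pathHasIndex_edge hγ h12 hc₂ r₂)).trans (hR.pathHasIndex_edge hγ h23 hc₃ r₃)).trans
    (hR.pathHasIndex_edge hγ h34 hc₄ r₄)).trans (hR.pathHasIndex_edge hγ p₄.2.2 (hc j) r₅)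
  rcases key with ⟨h01, -⟩ | ⟨-, key⟩
  · exact absurd h01 (by simp)
  replace key : HasIndex (ratio (extend γ)) 0 1 _ := key
  convert key using 1
  fin_cases j <;> simp [corner, edgeIndex] <;> ring

/-! ### Homotopies -/

/-- If `H` is polynomial without zeros on each rectangle of a grid in the unit square, and if
`H(·, 0) = H(·, 1)`, then the paths `H(0, ·)` and `H(1, ·)` have the same index. -/
theorem RealClosed.hasIndex_homotopy (hR : RealClosed R) {H : R → R → Cx R} (E₁ E₂ : Finset R)
    (hpoly : ∀ a b c d, 0 ≤ a → a < b → b ≤ 1 → 0 ≤ c → c < d → d ≤ 1 →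
      (∀ x ∈ E₁, ¬ (a < x ∧ x < b)) → (∀ y ∈ E₂, ¬ (c < y ∧ y < d)) →
      ∃ P Q : R[X][X], ∀ x y, a ≤ x → x ≤ b → c ≤ y → y ≤ d →
        H x y = ⟨P.evalEval x y, Q.evalEval x y⟩)
    (h0 : ∀ x y, 0 ≤ x → x ≤ 1 → 0 ≤ y → y ≤ 1 → H x y ≠ 0)
    (hends : ∀ x, 0 ≤ x → x ≤ 1 → H x 0 = H x 1) :
    ∃ q, HasIndex (ratio (H 0)) 0 1 q ∧ HasIndex (ratio (H 1)) 0 1 q := by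
  refine interval_induction E₁
    (Φ := fun a b => ∃ q, HasIndex (ratio (H a)) 0 1 q ∧ HasIndex (ratio (H b)) 0 1 q)
    ?_ ?_ zero_lt_one
  · rintro a b c - - - - ⟨q, h1, h2⟩ ⟨r, h3, h4⟩
    obtain rfl := h2.unique h3
    exact ⟨q, h1, h4⟩
  intro a b ha hab hb hE₁
  -- the boundary index of the strip `[a,b] × [0,1]`, obtained by adding up those of its rectangles
  have hstrip : ∃ q₀ q₁ p₀ p₁, HasIndex (ratio (H a)) 0 1 q₀ ∧ HasIndex (ratio (H b)) 0 1 q₁ ∧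
      HasIndex (ratio fun x => H x 0) a b p₀ ∧ HasIndex (ratio fun x => H x 1) a b p₁ ∧
      q₀ + p₁ - q₁ - p₀ = 0 := by
    refine interval_induction E₂ (Φ := fun c d => ∃ q₀ q₁ p₀ p₁, HasIndex (ratio (H a)) c d q₀ ∧
      HasIndex (ratio (H b)) c d q₁ ∧ HasIndex (ratio fun x => H x c) a b p₀ ∧
      HasIndex (ratio fun x => H x d) a b p₁ ∧ q₀ + p₁ - q₁ - p₀ = 0) ?_ ?_ zero_lt_one
    · rintro c d e - hcd hde - ⟨q₀, q₁, p₀, p₁, h1, h2, h3, h4, h5⟩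
        ⟨r₀, r₁, s₀, s₁, k1, k2, k3, k4, k5⟩
      obtain rfl := h4.unique k3
      exact ⟨_, _, _, _, h1.trans k1 hcd hde, h2.trans k2 hcd hde, h3, k4,
        by linear_combination h5 + k5⟩
    · intro c d hc hcd hd hE₂
      obtain ⟨P, Q, hH⟩ := hpoly a b c d ha hab hb hc hcd hd hE₁ hE₂
      have hrow : ∀ x, a ≤ x → x ≤ b → ∀ y, c ≤ y → y ≤ d →
          H x y = ⟨(row P x).eval y, (row Q x).eval y⟩ := fun x h1 h2 y h3 h4 => by
        rw [hH x y h1 h2 h3 h4, eval_row, eval_row]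
      have hcol : ∀ y, c ≤ y → y ≤ d → ∀ x, a ≤ x → x ≤ b →
          H x y = ⟨(col P y).eval x, (col Q y).eval x⟩ := fun y h1 h2 x h3 h4 =>
        hH x y h3 h4 h1 h2
      refine ⟨_, _, _, _, hasIndex_ratio hcd (hrow a le_rfl hab.le),
        hasIndex_ratio hcd (hrow b hab.le le_rfl), hasIndex_ratio hab (hcol c le_rfl hcd.le),
        hasIndex_ratio hab (hcol d hcd.le le_rfl), ?_⟩
      exact hR.boundaryIndex_eq_zero hab hcd fun x h1 h2 => noCommonZero_of_path (hrow x h1 h2)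
        fun y h3 h4 => h0 x y (ha.trans h1) (h2.trans hb) (hc.trans h3) (h4.trans hd)
  obtain ⟨q₀, q₁, p₀, p₁, h1, h2, h3, h4, h5⟩ := hstrip
  have h3' : HasIndex (ratio fun x => H x 1) a b p₀ := h3.congr hab fun x h1 h2 => by
    simp only [ratio, hends x (ha.trans h1.le) (h2.le.trans hb)]
  obtain rfl := h3'.unique h4
  obtain rfl : q₀ = q₁ := by linear_combination h5
  exact ⟨q₀, h1, h2⟩

theorem RealClosed.hasIndex_of_homotopic (hR : RealClosed R) {γ₀ γ₁ : UI R → Cx R}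
    (h : Homotopic γ₀ γ₁) :
    ∃ q, HasIndex (ratio (extend γ₀)) 0 1 q ∧ HasIndex (ratio (extend γ₁)) 0 1 q := by
  classical
  obtain ⟨H, ⟨m, n, s, t, F, hs, ht, hF⟩, h0, hends, rfl, rfl⟩ := h
  have hext : ∀ x y, (hx0 : 0 ≤ x) → (hx1 : x ≤ 1) → (hy0 : 0 ≤ y) → (hy1 : y ≤ 1) →
      extend (fun u => extend (H u) y) x = H ⟨x, hx0, hx1⟩ ⟨y, hy0, hy1⟩ :=
    fun x y hx0 hx1 hy0 hy1 => by
      rw [extend_of_mem _ hx0 hx1, extend_of_mem _ hy0 hy1]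
  have := hR.hasIndex_homotopy (H := fun x y => extend (fun u => extend (H u) y) x)
    (Finset.univ.image s) (Finset.univ.image t) ?_ ?_ ?_
  · have e0 : (fun y => extend (fun u => extend (H u) y) 0) = extend (H 0) := by
      ext1 y; rw [extend_of_mem _ le_rfl zero_le_one]; rfl
    have e1 : (fun y => extend (fun u => extend (H u) y) 1) = extend (H 1) := by
      ext1 y; rw [extend_of_mem _ zero_le_one le_rfl]; rfl
    rwa [e0, e1] at this
  · intro a b c d ha hab hb hc hcd hd hE₁ hE₂
    obtain ⟨i, hi1, hi2⟩ := exists_subdivision_piece (t := s) (c := a) (d := b) (by rwa [hs.2.1])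
      (by rw [hs.2.2]; exact hab.trans_le hb) fun k => hE₁ _ (by simp)
    obtain ⟨j, hj1, hj2⟩ := exists_subdivision_piece (t := t) (c := c) (d := d) (by rwa [ht.2.1])
      (by rw [ht.2.2]; exact hcd.trans_le hd) fun k => hE₂ _ (by simp)
    obtain ⟨P, Q, hPQ⟩ := exists_re_im_evalEval (F i j)
    refine ⟨P, Q, fun x y h1 h2 h3 h4 => ?_⟩
    rw [hext x y (ha.trans h1) (h2.trans hb) (hc.trans h3) (h4.trans hd), ← hPQ]
    exact hF i j _ _ (hi1.trans h1) (h2.trans hi2) (hj1.trans h3) (h4.trans hj2)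
  · intro x y hx0 hx1 hy0 hy1
    rw [hext x y hx0 hx1 hy0 hy1]
    exact h0 _ _
  · intro x hx0 hx1
    rw [hext x 0 hx0 hx1 le_rfl zero_le_one, hext x 1 hx0 hx1 zero_le_one le_rfl]
    exact hends _

/-! ### The algebraic index of loops -/

theorem cx_mul_ne_zero {z w : Cx R} (hz : z ≠ 0) (hw : w ≠ 0) :
    z * w ≠ 0 := by
  intro h
  have hre : z.re * w.re - z.im * w.im = 0 := by
    simpa [sub_eq_add_neg] using congrArg QuadraticAlgebra.re h
  have him : z.re * w.im + z.im * w.re = 0 := by simpa using congrArg QuadraticAlgebra.im h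
  have hn : ∀ {z : Cx R}, z ≠ 0 → z.re ^ 2 + z.im ^ 2 ≠ 0 := by
    intro z hz
    by_cases h0 : z.im = 0
    · have := cx_ne_zero_iff.1 hz h0
      positivity
    · positivity
  refine mul_ne_zero (hn hz) (hn hw) ?_
  linear_combination (z.re * w.re - z.im * w.im) * hre + (z.re * w.im + z.im * w.re) * him

theorem extend_ne_zero {γ : UI R → Cx R} (h : ∀ x, γ x ≠ 0) (x : R) : extend γ x ≠ 0 := h _

theorem mul_mem_loops {γ₁ γ₂ : UI R → Cx R} (h₁ : γ₁ ∈ Loops R) (h₂ : γ₂ ∈ Loops R) :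
    γ₁ * γ₂ ∈ Loops R := by
  refine ⟨PiecewisePolyOn.isPiecewisePoly ?_, fun x => cx_mul_ne_zero (h₁.2.1 x) (h₂.2.1 x), ?_⟩
  · exact h₁.1.piecewisePolyOn.mul h₂.1.piecewisePolyOn
  · rw [Pi.mul_apply, Pi.mul_apply, h₁.2.2, h₂.2.2]

theorem extend_zero_eq_one {γ : UI R → Cx R} (h : γ ∈ Loops R) : extend γ 0 = extend γ 1 := by
  rw [extend_of_mem γ le_rfl zero_le_one, extend_of_mem γ zero_le_one le_rfl]
  exact h.2.2

theorem RealClosed.exists_int_hasIndex (hR : RealClosed R) (γ : Loops R) :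
    ∃ m : ℤ, HasIndex (ratio (extend γ.1)) 0 1 (2 * m) := by
  obtain ⟨m, hm⟩ := hR.hasIndex_turn zero_lt_one γ.2.1.piecewisePolyOn
    fun x _ _ => extend_ne_zero γ.2.2.1 x
  refine ⟨m, ?_⟩
  rwa [extend_zero_eq_one γ.2, sub_self, zero_add] at hm

end AlgIndex

theorem mainTheorem3 {R : Type*} [Field R] [LinearOrder R] [IsStrictOrderedRing R]
    (hR : AlgIndex.RealClosed R) :
    ∃ ind : AlgIndex.Loops R → ℤ,
      -- Computation by Cauchy indices and by Sturm chains
      (∀ (γ : AlgIndex.Loops R) (n : ℕ) (t : Fin (n + 1) → R)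
          (G : Fin n → Polynomial (AlgIndex.Cx R)),
        AlgIndex.IsPresentation γ.1 t G →
          (ind γ : ℚ) = ∑ k : Fin n, AlgIndex.segIndex (G k) (t k.castSucc) (t k.succ) ∧
          (ind γ : ℚ) = ∑ k : Fin n, AlgIndex.segSturm (G k) (t k.castSucc) (t k.succ)) ∧
      -- Normalization
      (∀ (γ : AlgIndex.Loops R) (x₀ x₁ y₀ y₁ : R), x₀ < x₁ → y₀ < y₁ →
        AlgIndex.ParametrizesBoundary γ.1 x₀ x₁ y₀ y₁ →
          ((x₀ < 0 ∧ 0 < x₁ ∧ y₀ < 0 ∧ 0 < y₁) → ind γ = 1) ∧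
          (¬ (x₀ ≤ 0 ∧ 0 ≤ x₁ ∧ y₀ ≤ 0 ∧ 0 ≤ y₁) → ind γ = 0)) ∧
      -- Multiplicativity
      (∀ γ₁ γ₂ : AlgIndex.Loops R, ∃ h : γ₁.1 * γ₂.1 ∈ AlgIndex.Loops R,
        ind ⟨γ₁.1 * γ₂.1, h⟩ = ind γ₁ + ind γ₂) ∧
      -- Homotopy invariance
      (∀ γ₀ γ₁ : AlgIndex.Loops R, AlgIndex.Homotopic γ₀.1 γ₁.1 → ind γ₀ = ind γ₁) := by
  open AlgIndex in
  choose ind hind using hR.exists_int_hasIndex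
  refine ⟨ind, ?_, ?_, ?_, ?_⟩
  · intro γ n t G h
    have h1 : (ind γ : ℚ) = ∑ k : Fin n, segIndex (G k) (t k.castSucc) (t k.succ) := by
      have := (hind γ).unique h.hasIndex
      linarith
    refine ⟨h1, h1.trans (Finset.sum_congr rfl fun k _ => ?_)⟩
    refine (hR.segSturm_eq (h.1.1 Fin.castSucc_lt_succ) fun x h2 h3 => ?_).symm
    rw [← h.eq_eval k h2 h3]
    exact extend_ne_zero γ.2.2.1 x
  · intro γ x₀ x₁ y₀ y₁ hx hy h
    have h1 := (hind γ).unique (hR.hasIndex_rectangle γ.2.1.piecewisePolyOn h)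
    constructor
    · rintro ⟨hx₀, hx₁, hy₀, hy₁⟩
      rw [sgn_pos hx₁, sgn_neg hx₀, sgn_pos hy₁, sgn_neg hy₀] at h1
      have : (ind γ : ℚ) = 1 := by linarith
      exact_mod_cast this
    · intro hout
      have hzero : (sgn x₁ - sgn x₀) * (sgn y₁ - sgn y₀) = 0 := by
        by_contra hne
        obtain ⟨hne1, hne2⟩ := mul_ne_zero_iff.1 hne
        refine hout ⟨?_, ?_, ?_, ?_⟩ <;> by_contra! hcon
        · exact hne1 (by rw [sgn_pos hcon, sgn_pos (hcon.trans hx), sub_self])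
        · exact hne1 (by rw [sgn_neg hcon, sgn_neg (hx.trans hcon), sub_self])
        · exact hne2 (by rw [sgn_pos hcon, sgn_pos (hcon.trans hy), sub_self])
        · exact hne2 (by rw [sgn_neg hcon, sgn_neg (hy.trans hcon), sub_self])
      rw [hzero] at h1
      have : (ind γ : ℚ) = 0 := by linarith
      exact_mod_cast this
  · intro γ₁ γ₂
    refine ⟨mul_mem_loops γ₁.2 γ₂.2, ?_⟩
    obtain ⟨q₁, q₂, h1, h2, h3⟩ := hR.hasIndex_mul zero_lt_one γ₁.2.1.piecewisePolyOn
      (fun x _ _ => extend_ne_zero γ₁.2.2.1 x) γ₂.2.1.piecewisePolyOn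
      fun x _ _ => extend_ne_zero γ₂.2.2.1 x
    rw [extend_zero_eq_one γ₁.2, extend_zero_eq_one γ₂.2, sub_self, mul_zero, add_zero] at h3
    have e1 := (hind γ₁).unique h1
    have e2 := (hind γ₂).unique h2
    have e3 := (hind ⟨γ₁.1 * γ₂.1, mul_mem_loops γ₁.2 γ₂.2⟩).unique h3
    have : (ind ⟨γ₁.1 * γ₂.1, mul_mem_loops γ₁.2 γ₂.2⟩ : ℚ) = ind γ₁ + ind γ₂ := by linarith
    exact_mod_cast this
  · intro γ₀ γ₁ h
    obtain ⟨q, h0, h1⟩ := hR.hasIndex_of_homotopic h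
    have e0 := (hind γ₀).unique h0
    have e1 := (hind γ₁).unique h1
    have : (ind γ₀ : ℚ) = ind γ₁ := by linarith
    exact_mod_cast this
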